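/- \textbf{Conventions.} All spaces are pointed spaces of the pointed homotopy type of a CW complex (with a vertex as base point); $X$ is path-connected. All numbers below lie in $\{0,1,2,\dots,\infty\}$. For a map $f:K\to X$, $\operatorname{cat}(f)$ is the smallest $n\ge 0$ such that $K$ is covered by $n+1$ open subsets on each of which $f$ is homotopic to the constant map at the base point ($\infty$ if there is none), and $\operatorname{cat}(X)=\operatorname{cat}(\mathrm{id}_X)$ is the (normalised) Lusternik–Schnirelmann category. $\operatorname{cuplen}(X)$ is the supremum of $k\ge 0$ such that the reduced iterated diagonal $\overline{\Delta}^k:X\to\wedge^kX$ is stably non-trivial, i.e. $\Sigma^n\overline{\Delta}^k$ is not null-homotopic for any $n\ge 0$ ($k=0$ always counts). A cohomology theory $h$ is a generalised reduced cohomology theory: homotopy invariant contravariant functors $\tilde h^n$ ($n\in\mathbb Z$) to abelian groups that are exact on cofibre sequences $A\to B\to C_f$, with natural suspension isomorphisms $\tilde h^n(A)\cong\tilde h^{n+1}(\Sigma A)$. By $h^*h$ we denote its stable cohomology operations, i.e. the natural homomorphisms $\tilde h^*\to\tilde h^{*+d}$ ($d\in\mathbb Z$) that commute with the suspension isomorphisms.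 For $u\in\tilde h^*(X)$ let $$\operatorname{wgt}(u;h)=\sup\{m\ge 0\mid f^*(u)=0\text{ for all } f:K\to X\text{ with }\operatorname{cat}(f)<m\},$$ let $\operatorname{wgt}(X;h)$ be the supremum of $\operatorname{wgt}(u;h)$ over all $0\ne u\in\tilde h^*(X)$ ($0$ if there are none), and let $\operatorname{wgt}(X)$ be the supremum of $\operatorname{wgt}(X;h)$ over all cohomology theories $h$. Let $e_m:P^m\Omega X\to X$ be the maps of the fibre–cofibre (Ganea) construction: $P^0\Omega X=\{*\}$, and $P^{m+1}\Omega X$ is the mapping cone of the mapping fibre of $e_m$, with $e_{m+1}$ the induced extension of $e_m$; thus $P^m\Omega X$ is the projective $m$-space of the loop space $\Omega X$. For a set $\Gamma\subset h^*h$, let $$\operatorname{Mwgt}(X;\Gamma)=\min\{m\ge 0\mid (e_m)^*:\tilde h^*(X)\to\tilde h^*(P^m\Omega X)\text{ is injective and its image is a }\Gamma\text{-direct summand}\}$$ ($\infty$ if there is no such $m$), where a graded subgroup is a $\Gamma$-direct summand if it and some graded complement of it are closed under the operations in $\Gamma$. Let $\operatorname{Mwgt}(X)$ be the supremum of $\operatorname{Mwgt}(X;h^*h)$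 over all cohomology theories $h$. \textbf{Theorem.} For every such $X$, $$\operatorname{cuplen}(X)\le\operatorname{wgt}(X)\le\operatorname{Mwgt}(X)\le\operatorname{cat}(X).$$ -/

import Mathlib

open scoped unitInterval

universe u

noncomputable section

namespace LS

/-! ### Pointed spaces and pointed maps -/

/-- A pointed topological space. -/
structure PointedSpace : Type (u + 1) where
  carrier : Type u
  [top : TopologicalSpace carrier]
  base : carrier

attribute [instance] PointedSpace.top

instance : CoeSort PointedSpace.{u} (Type u) := ⟨PointedSpace.carrier⟩

/-- A pointed continuous map. -/
@[ext]
structure PMap (X Y : PointedSpace.{u}) : Type u where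
  toMap : C(X, Y)
  map_base : toMap X.base = Y.base

namespace PMap

/-- The identity map. -/
def id (X : PointedSpace.{u}) : PMap X X := ⟨ContinuousMap.id X, rfl⟩

/-- Composition `g ∘ f` of pointed maps. -/
def comp {X Y Z : PointedSpace.{u}} (g : PMap Y Z) (f : PMap X Y) : PMap X Z :=
  ⟨g.toMap.comp f.toMap, by simp [f.map_base, g.map_base]⟩

/-- The constant map at the base point. -/
def const (X Y : PointedSpace.{u}) : PMap X Y := ⟨ContinuousMap.const X Y.base, rfl⟩

/-- Pointed homotopy: the base point stays fixed during the homotopy. -/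
def Homotopic {X Y : PointedSpace.{u}} (f g : PMap X Y) : Prop :=
  ContinuousMap.HomotopicRel f.toMap g.toMap {X.base}

end PMap

/-- `X` is (homeomorphic to) a pointed CW complex: Hausdorff, with a CW structure one of whose
vertices is the base point. -/
def IsPointedCW (X : PointedSpace.{u}) : Prop :=
  T2Space X ∧ ∃ (_ : Topology.CWComplex (Set.univ : Set X))
    (i : Topology.CWComplex.cell (Set.univ : Set X) 0),
    X.base ∈ Topology.CWComplex.closedCell (C := (Set.univ : Set X)) 0 i

/-- `X` has the pointed homotopy type of a pointed CW complex. -/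
def HasCWType (X : PointedSpace.{u}) : Prop :=
  ∃ (Y : PointedSpace.{u}) (f : PMap X Y) (g : PMap Y X), IsPointedCW Y ∧
    (g.comp f).Homotopic (PMap.id X) ∧ (f.comp g).Homotopic (PMap.id Y)

/-- Pointed spaces of the pointed homotopy type of a CW complex. -/
structure CWSpace : Type (u + 1) extends PointedSpace.{u} where
  hasCWType : HasCWType toPointedSpace

/-! ### Quotients, suspensions, smash powers, mapping cones -/

/-- The equivalence relation that identifies all points of `A` with each other. -/
def collapseSetoid {Z : Type u} (A : Set Z) : Setoid Z where
  r x y := x = y ∨ (x ∈ A ∧ y ∈ A)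
  iseqv :=
    { refl := fun _ => Or.inl rfl
      symm := by
        rintro x y (h | h)
        · exact Or.inl h.symm
        · exact Or.inr h.symm
      trans := by
        rintro x y z (rfl | h) (rfl | h')
        · exact Or.inl rfl
        · exact Or.inr h'
        · exact Or.inr h
        · exact Or.inr ⟨h.1, h'.2⟩ }

/-- The quotient space `Z / A`, with base point the class of `a`; it is used for `a ∈ A`. -/
def collapse (Z : Type u) [TopologicalSpace Z] (A : Set Z) (a : Z) : PointedSpace.{u} where
  carrier := Quotient (collapseSetoid A)
  base := Quotient.mk _ a

/-- The map `Z / A → W / B` induced by `f : Z → W` with `f A ⊆ B` and `f a = b`. -/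
def collapseMap {Z W : Type u} [TopologicalSpace Z] [TopologicalSpace W] {A : Set Z} {B : Set W}
    {a : Z} {b : W} (f : C(Z, W)) (hf : Set.MapsTo f A B) (hab : f a = b) :
    PMap (collapse Z A a) (collapse W B b) where
  toMap :=
    { toFun := Quotient.map' f (by
        rintro x y (rfl | h)
        · exact Or.inl rfl
        · exact Or.inr ⟨hf h.1, hf h.2⟩)
      continuous_toFun := f.continuous.quotient_map' _ }
  map_base := congrArg (Quotient.mk (collapseSetoid B)) hab

/-- The subspace of `X × [0,1]` that is collapsed in the reduced suspension. -/
def suspSet (X : PointedSpace.{u}) : Set (X × I) := {p | p.1 = X.base ∨ p.2 = 0 ∨ p.2 = 1}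

/-- The reduced suspension `ΣX = X × [0,1] / (X × {0,1} ∪ {*} × [0,1])`. -/
def susp (X : PointedSpace.{u}) : PointedSpace.{u} :=
  collapse (X × I) (suspSet X) (X.base, 0)

/-- The suspension `Σf` of a pointed map. -/
def suspMap {X Y : PointedSpace.{u}} (f : PMap X Y) : PMap (susp X) (susp Y) :=
  collapseMap (f.toMap.prodMap (ContinuousMap.id I))
    (by
      rintro ⟨x, t⟩ (h | h)
      · left
        change x = X.base at h
        subst h
        exact f.map_base
      · exact Or.inr h)
    (Prod.ext f.map_base rfl)

/-- The `n`-fold reduced suspension. -/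
def iterSusp (X : PointedSpace.{u}) : ℕ → PointedSpace.{u}
  | 0 => X
  | n + 1 => susp (iterSusp X n)

/-- The `n`-fold suspension of a pointed map. -/
def iterSuspMap {X Y : PointedSpace.{u}} (f : PMap X Y) :
    (n : ℕ) → PMap (iterSusp X n) (iterSusp Y n)
  | 0 => f
  | n + 1 => suspMap (iterSuspMap f n)

/-- A pointed map is stably non-trivial if none of its iterated suspensions is null-homotopic. -/
def StablyNontrivial {X Y : PointedSpace.{u}} (f : PMap X Y) : Prop :=
  ∀ n : ℕ, ¬ (iterSuspMap f n).Homotopic (PMap.const _ _)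

/-- The fat wedge in `X ^ k`: the tuples with at least one coordinate at the base point. -/
def fatWedge (X : PointedSpace.{u}) (k : ℕ) : Set (Fin k → X) := {x | ∃ i, x i = X.base}

/-- The `k`-fold smash power `∧ᵏ X = Xᵏ / Tᵏ X`, for `k ≥ 1`. -/
def smashPower (X : PointedSpace.{u}) (k : ℕ) : PointedSpace.{u} :=
  collapse (Fin k → X) (fatWedge X k) (fun _ => X.base)

/-- The reduced iterated diagonal `X → ∧ᵏ X`, for `k ≥ 1`. -/
def reducedDiagonal (X : PointedSpace.{u}) (k : ℕ) : PMap X (smashPower X k) where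
  toMap :=
    { toFun := fun x => Quotient.mk (collapseSetoid (fatWedge X k)) (fun _ => x)
      continuous_toFun := continuous_quotient_mk'.comp (continuous_pi fun _ => continuous_id) }
  map_base := rfl

/-- The gluing relation of the mapping cone of `p : E → Y`: the end `E × {1}` is glued to `Y` along
`p` and the end `E × {0}` is collapsed to one point, the vertex. -/
inductive ConeRel {E Y : Type u} (p : E → Y) : Y ⊕ (E × I) → Y ⊕ (E × I) → Prop
  | glue (z : E) : ConeRel p (Sum.inr (z, 1)) (Sum.inl (p z))
  | vertex (z z' : E) : ConeRel p (Sum.inr (z, 0)) (Sum.inr (z', 0))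

/-- The (unreduced) mapping cone `Y ∪_p CE`. -/
def MappingCone {E Y : Type u} (p : E → Y) : Type u := Quot (ConeRel p)

instance {E Y : Type u} [TopologicalSpace E] [TopologicalSpace Y] (p : E → Y) :
    TopologicalSpace (MappingCone p) :=
  inferInstanceAs (TopologicalSpace (Quot (ConeRel p)))

/-- The image in the mapping cone of `f` of the cone over the base point. -/
def coneLine {X Y : PointedSpace.{u}} (f : PMap X Y) : Set (MappingCone f.toMap) :=
  Set.range fun t : I => Quot.mk _ (Sum.inr (X.base, t))

/-- The reduced mapping cone `C_f` of a pointed map, that is, the mapping cone with the cone over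
the base point collapsed. -/
def reducedCone {X Y : PointedSpace.{u}} (f : PMap X Y) : PointedSpace.{u} :=
  collapse (MappingCone f.toMap) (coneLine f) (Quot.mk _ (Sum.inl Y.base))

/-- The inclusion `Y → C_f`. -/
def reducedConeIncl {X Y : PointedSpace.{u}} (f : PMap X Y) : PMap Y (reducedCone f) where
  toMap :=
    { toFun := fun y => Quotient.mk (collapseSetoid (coneLine f)) (Quot.mk _ (Sum.inl y))
      continuous_toFun :=
        continuous_quotient_mk'.comp (continuous_quot_mk.comp continuous_inl) }
  map_base := rfl

/-! ### Lusternik–Schnirelmann category and stable cup-length -/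

/-- The L-S category of a map `f : K → X`: the least `n` such that `K` is covered by `n + 1` open
subsets on each of which `f` is homotopic to the constant map at the base point of `X`; it is `⊤` if
there is no such `n`. -/
def catMap {K X : PointedSpace.{u}} (f : PMap K X) : ℕ∞ :=
  ⨅ (n : ℕ) (_ : ∃ U : Fin (n + 1) → Set K, (∀ i, IsOpen (U i)) ∧ (⋃ i, U i) = Set.univ ∧
    ∀ i, ContinuousMap.Homotopic (f.toMap.restrict (U i)) (ContinuousMap.const (U i) X.base)),
    (n : ℕ∞)

/-- The (normalised) L-S category of `X`, given by covers by open subsets whose inclusion into `X`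
is homotopic to the constant map at the base point. -/
def cat (X : PointedSpace.{u}) : ℕ∞ := catMap (PMap.id X)

/-- The stable cup-length: the supremum of the `k` such that the reduced iterated diagonal
`X → ∧ᵏ X` is stably non-trivial (`k = 0` always counts, so that the value is at least `0`). -/
def cuplen (X : PointedSpace.{u}) : ℕ∞ :=
  ⨆ (k : ℕ) (_ : 1 ≤ k) (_ : StablyNontrivial (reducedDiagonal X k)), (k : ℕ∞)

/-! ### Cohomology theories, operations -/

/-- A (generalised) reduced cohomology theory on the pointed spaces of the homotopy type of CW
complexes: contravariant functors `h ^ n` to abelian groups that are homotopy invariant, exact on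
cofibre sequences `X → Y → C_f`, with natural suspension isomorphisms `h ^ n X ≅ h ^ (n + 1) (ΣX)`.

Reduced suspensions and reduced mapping cones of spaces of the homotopy type of CW complexes are
again of this type; the arguments `hS` and `hC` record just this and are no restriction. -/
structure CohomologyTheory : Type (u + 1) where
  obj : ℤ → CWSpace.{u} → Type u
  [grp : ∀ n X, AddCommGroup (obj n X)]
  map : ∀ (n : ℤ) {X Y : CWSpace.{u}}, PMap X.toPointedSpace Y.toPointedSpace →
    (obj n Y →+ obj n X)
  map_id : ∀ (n : ℤ) (X : CWSpace.{u}) (u : obj n X), map n (PMap.id X.toPointedSpace) u = u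
  map_comp : ∀ (n : ℤ) {X Y Z : CWSpace.{u}} (g : PMap Y.toPointedSpace Z.toPointedSpace)
    (f : PMap X.toPointedSpace Y.toPointedSpace) (u : obj n Z),
    map n (g.comp f) u = map n f (map n g u)
  map_homotopic : ∀ (n : ℤ) {X Y : CWSpace.{u}} (f g : PMap X.toPointedSpace Y.toPointedSpace),
    f.Homotopic g → map n f = map n g
  exact : ∀ (n : ℤ) {X Y : CWSpace.{u}} (f : PMap X.toPointedSpace Y.toPointedSpace)
    (hC : HasCWType (reducedCone f)) (u : obj n Y),
    map n f u = 0 ↔ ∃ v : obj n ⟨reducedCone f, hC⟩,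
      map n (X := Y) (Y := ⟨reducedCone f, hC⟩) (reducedConeIncl f) v = u
  suspIso : ∀ (n m : ℤ), n + 1 = m → ∀ (X : CWSpace.{u}) (hS : HasCWType (susp X.toPointedSpace)),
    obj n X ≃+ obj m ⟨susp X.toPointedSpace, hS⟩
  suspIso_natural : ∀ (n m : ℤ) (hnm : n + 1 = m) {X Y : CWSpace.{u}}
    (hX : HasCWType (susp X.toPointedSpace)) (hY : HasCWType (susp Y.toPointedSpace))
    (f : PMap X.toPointedSpace Y.toPointedSpace) (u : obj n Y),
    map m (X := ⟨susp X.toPointedSpace, hX⟩) (Y := ⟨susp Y.toPointedSpace, hY⟩) (suspMap f)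
      (suspIso n m hnm Y hY u) = suspIso n m hnm X hX (map n f u)

attribute [instance] CohomologyTheory.grp

/-- A (homogeneous) stable cohomology operation on `h`, an element of `h ^ d h`: natural
homomorphisms `h ^ n → h ^ (n + d)` that commute with the suspension isomorphisms. -/
structure StableOperation (h : CohomologyTheory.{u}) : Type (u + 1) where
  degree : ℤ
  app : ∀ (n m : ℤ), n + degree = m → ∀ X : CWSpace.{u}, h.obj n X →+ h.obj m X
  natural : ∀ (n m : ℤ) (hnm : n + degree = m) {X Y : CWSpace.{u}}
    (f : PMap X.toPointedSpace Y.toPointedSpace) (u : h.obj n Y),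
    h.map m f (app n m hnm Y u) = app n m hnm X (h.map n f u)
  stable : ∀ (n m n' m' : ℤ) (hnm : n + degree = m) (hnm' : n' + degree = m') (hn : n + 1 = n')
    (hm : m + 1 = m') (X : CWSpace.{u}) (hS : HasCWType (susp X.toPointedSpace)) (u : h.obj n X),
    app n' m' hnm' ⟨susp X.toPointedSpace, hS⟩ (h.suspIso n n' hn X hS u) =
      h.suspIso m m' hm X hS (app n m hnm X u)

namespace CohomologyTheory

variable (h : CohomologyTheory.{u})

/-- The value `h ^ n P` on a pointed space `P` for which no CW structure is at hand: a class on `P`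
is a family of classes `u_g ∈ h ^ n K`, one for every map `g : K → P` from a space of the homotopy
type of a CW complex, that is compatible with maps over `P`. If `P` itself is of the homotopy type
of a CW complex, then this is canonically the group `h ^ n P` of the theory, see
`toOnSpace_bijective`. -/
def onSpace (n : ℤ) (P : PointedSpace.{u}) :
    AddSubgroup (∀ K : CWSpace.{u}, PMap K.toPointedSpace P → h.obj n K) where
  carrier := {u | ∀ (K L : CWSpace.{u}) (φ : PMap K.toPointedSpace L.toPointedSpace)
    (g : PMap L.toPointedSpace P), u K (g.comp φ) = h.map n φ (u L g)}
  zero_mem' := by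
    intro K L φ g
    simp
  add_mem' := by
    intro u v hu hv K L φ g
    simp only [Set.mem_ofPred_eq, Pi.add_apply, map_add] at *
    rw [hu, hv]
  neg_mem' := by
    intro u hu K L φ g
    simp only [Set.mem_ofPred_eq, Pi.neg_apply, map_neg] at *
    rw [hu]

/-- The homomorphism `e^* : h ^ n X → h ^ n P` induced by `e : P → X`. -/
def pullback (n : ℤ) {P : PointedSpace.{u}} {X : CWSpace.{u}} (e : PMap P X.toPointedSpace) :
    h.obj n X →+ h.onSpace n P where
  toFun u := ⟨fun _ g => h.map n (e.comp g) u, by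
    intro K L φ g
    exact h.map_comp n (e.comp g) φ u⟩
  map_zero' := by
    ext K g
    simp
  map_add' u v := by
    ext K g
    simp

/-- On a space of the homotopy type of a CW complex, `onSpace` gives back the theory `h`. -/
theorem toOnSpace_bijective (n : ℤ) (X : CWSpace.{u}) :
    Function.Bijective (h.pullback n (PMap.id X.toPointedSpace)) := by
  constructor
  · intro u v huv
    have := congrFun (congrFun (congrArg Subtype.val huv) X) (PMap.id X.toPointedSpace)
    change h.map n (PMap.id X.toPointedSpace) u = h.map n (PMap.id X.toPointedSpace) v at this
    rwa [h.map_id, h.map_id] at this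
  · intro u
    refine ⟨u.1 X (PMap.id X.toPointedSpace), ?_⟩
    ext K g
    exact (u.2 K X g (PMap.id X.toPointedSpace)).symm

end CohomologyTheory

/-- The action of a stable operation on `h ^ * P`. -/
def StableOperation.onSpace {h : CohomologyTheory.{u}} (θ : StableOperation h) (n m : ℤ)
    (hnm : n + θ.degree = m) (P : PointedSpace.{u}) : h.onSpace n P →+ h.onSpace m P where
  toFun u := ⟨fun K g => θ.app n m hnm K (u.1 K g), by
    intro K L φ g
    change θ.app n m hnm K (u.1 K (g.comp φ)) = h.map m φ (θ.app n m hnm L (u.1 L g))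
    rw [u.2 K L φ g, θ.natural]⟩
  map_zero' := by
    ext K g
    simp
  map_add' u v := by
    ext K g
    simp

/-- A graded subgroup of `h ^ * P` that is closed under the operations in `Γ`. -/
def ClosedUnder {h : CohomologyTheory.{u}} (Γ : Set (StableOperation h)) {P : PointedSpace.{u}}
    (A : ∀ n : ℤ, AddSubgroup (h.onSpace n P)) : Prop :=
  ∀ θ ∈ Γ, ∀ (n m : ℤ) (hnm : n + θ.degree = m), ∀ u ∈ A n, θ.onSpace n m hnm P u ∈ A m

/-- `A` is a direct summand of `h ^ * P` as a module over `Γ`: both `A` and some complement of it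
are closed under the operations in `Γ`. -/
def IsDirectSummand {h : CohomologyTheory.{u}} (Γ : Set (StableOperation h)) {P : PointedSpace.{u}}
    (A : ∀ n : ℤ, AddSubgroup (h.onSpace n P)) : Prop :=
  ClosedUnder Γ A ∧ ∃ B : ∀ n : ℤ, AddSubgroup (h.onSpace n P),
    (∀ n, IsCompl (A n) (B n)) ∧ ClosedUnder Γ B

/-! ### The fibre-cofibre construction -/

/-- The mapping fibre of `e : P → X`: points `y` of `P` with a path in `X` from the base point
to `e y`. -/
def MappingFibre {P X : PointedSpace.{u}} (e : PMap P X) : Type u :=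
  {z : P × C(I, X) // z.2 0 = X.base ∧ z.2 1 = e.toMap z.1}

instance {P X : PointedSpace.{u}} (e : PMap P X) : TopologicalSpace (MappingFibre e) :=
  inferInstanceAs (TopologicalSpace {z : P × C(I, X) // z.2 0 = X.base ∧ z.2 1 = e.toMap z.1})

/-- The projection of the mapping fibre. -/
def MappingFibre.proj {P X : PointedSpace.{u}} (e : PMap P X) : MappingFibre e → P :=
  fun z => z.1.1

/-- A pointed space with a pointed map to `X`. -/
structure SpaceOver (X : PointedSpace.{u}) : Type (u + 1) where
  space : PointedSpace.{u}
  map : PMap space X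

/-- The extension of `e : P → X` over the mapping cone of the projection of its mapping fibre, which
uses the path `γ` on the cone over `(y, γ)`. -/
def coneExtend {P X : PointedSpace.{u}} (e : PMap P X) :
    C(MappingCone (MappingFibre.proj e), X) where
  toFun := Quot.lift (Sum.elim e.toMap fun w : MappingFibre e × I => w.1.1.2 w.2) (by
    rintro _ _ (z | ⟨z, z'⟩)
    · exact z.2.2
    · exact z.2.1.trans z'.2.1.symm)
  continuous_toFun := by
    refine continuous_quot_lift _ (continuous_sumElim.2 ⟨e.toMap.continuous, ?_⟩)
    have h1 : Continuous fun w : MappingFibre e × I => w.1.1.2 :=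
      continuous_snd.comp (continuous_subtype_val.comp continuous_fst)
    exact h1.eval continuous_snd

/-- One step of the fibre-cofibre construction: from `e : P → X` to the mapping cone of the mapping
fibre of `e`, with the induced map to `X`. -/
def ganeaStep {X : PointedSpace.{u}} (S : SpaceOver X) : SpaceOver X where
  space := ⟨MappingCone (MappingFibre.proj S.map), Quot.mk _ (Sum.inl S.space.base)⟩
  map := ⟨coneExtend S.map, S.map.map_base⟩

/-- The fibre-cofibre construction of `X`, starting from `P⁰ = {*}`. -/
def ganea (X : PointedSpace.{u}) : ℕ → SpaceOver X
  | 0 => ⟨⟨PUnit.{u + 1}, PUnit.unit⟩, PMap.const _ X⟩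
  | m + 1 => ganeaStep (ganea X m)

/-- The projective `m`-space `P ^ m ΩX` of the loop space, as the `m`-th space of the fibre-cofibre
construction. -/
def projSpace (X : PointedSpace.{u}) (m : ℕ) : PointedSpace.{u} := (ganea X m).space

/-- The natural map `e_m : P ^ m ΩX → X`. -/
def projMap (X : PointedSpace.{u}) (m : ℕ) : PMap (projSpace X m) X := (ganea X m).map

/-! ### Category weight and module weight -/

/-- The category weight of a class `u`: the largest `m` such that `f^* u = 0` for all `f : K → X`
with `cat f < m`, or `⊤` if there is no largest one. -/
def wgtClass (h : CohomologyTheory.{u}) {n : ℤ} {X : CWSpace.{u}} (u : h.obj n X) : ℕ∞ :=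
  ⨆ (m : ℕ) (_ : ∀ (K : CWSpace.{u}) (f : PMap K.toPointedSpace X.toPointedSpace),
    catMap f < (m : ℕ∞) → h.map n f u = 0), (m : ℕ∞)

/-- The category weight of `X` with respect to `h`, the supremum over all non-zero classes. -/
def wgtOf (h : CohomologyTheory.{u}) (X : CWSpace.{u}) : ℕ∞ :=
  ⨆ (n : ℤ) (u : h.obj n X) (_ : u ≠ 0), wgtClass h u

/-- The category weight of `X`, the supremum over all cohomology theories. -/
def wgt (X : CWSpace.{u}) : ℕ∞ := ⨆ h : CohomologyTheory.{u}, wgtOf h X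

/-- The module weight of `X` with respect to a set `Γ` of operations on `h`: the least `m` such that
`(e_m)^*` embeds `h ^ * X` into `h ^ * (P ^ m ΩX)` as a direct summand over `Γ`; it is `⊤` if
there is no such `m`. -/
def MwgtOf (h : CohomologyTheory.{u}) (Γ : Set (StableOperation h)) (X : CWSpace.{u}) : ℕ∞ :=
  ⨅ (m : ℕ) (_ : (∀ n : ℤ, Function.Injective (h.pullback n (projMap X.toPointedSpace m))) ∧
    IsDirectSummand Γ fun n : ℤ => (h.pullback n (projMap X.toPointedSpace m)).range), (m : ℕ∞)

/-- The module weight of `X`, the supremum over all cohomology theories, each with all its stable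
operations. -/
def Mwgt (X : CWSpace.{u}) : ℕ∞ := ⨆ h : CohomologyTheory.{u}, MwgtOf h Set.univ X

end LS

end

/-! All three inequalities come from open covers on whose members a map contracts.

Bound by `cat`: if `X` has a cover of size `n + 1`, then `e_n` has a homotopy section `s`
(`HasCatCover.exists_section`, Ganea). Hence `s^*` is a left inverse of `(e_n)^*`, so `(e_n)^*` is
injective and its image is complemented by the kernel of `s^*`; naturality makes both closed under
every operation. The section is built stage by stage from a numerable cover. Where a lift to the
current stage and a null-homotopy are both defined, the null-homotopy followed by the reversed
lifting homotopy is a path that defines a point of the mapping fibre, and the cone coordinate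
interpolates between the two (`exists_lift_ganeaStep`).

Bound by `Mwgt`: `e_m` itself has category at most `m` (`hasCatCover_projMap`), since coning off a
mapping fibre costs one more open set. A class of weight above `m` therefore dies on `P^m`, so
injectivity of `(e_m)^*` forces it to vanish.

Bound of `cuplen`: if `cat f < k`, then contracting each coordinate of `(f, ..., f)` over its own
open set pushes the diagonal into the fat wedge, so the reduced diagonal composed with `f` is
null-homotopic. In stable cohomotopy with coefficients in `∧ᵏ X`, the reduced diagonal gives a class
that is non-zero exactly by stable non-triviality, and this class has weight at least `k`. That
theory is represented by the colimit over `j` of maps into `Ω² Ω^j Σ^(j+n)`; the two extra loops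
supply abelian group structures by Eckmann-Hilton.

Covers are free while the conclusions are pointed. This is repaired on a CW model: the complex is
normal, so finite open covers are numerable, and its base vertex has a neighbourhood that deforms to
it, so one null-homotopy can be made to fix the base point (`exists_nullCover`). -/

noncomputable section

namespace LS

open Topology Metric Set Topology.RelCWComplex

/-! ### Maps out of CW complexes, built cell by cell -/

section CellularExtension

variable {Y : Type u} [TopologicalSpace Y] [CWComplex (univ : Set Y)]

/-- Every point of a CW complex lies in an open cell. -/
theorem exists_mem_openCell (y : Y) :
    ∃ p : Σ n, cell (univ : Set Y) n, y ∈ openCell p.1 p.2 := by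
  have : y ∈ (univ : Set Y) := mem_univ y
  rw [← CWComplex.iUnion_openCell_eq_complex (C := (univ : Set Y))] at this
  simp only [mem_iUnion] at this
  obtain ⟨n, i, h⟩ := this
  exact ⟨⟨n, i⟩, h⟩

/-- The open cell containing a point. -/
def cellOf (y : Y) : Σ n, cell (univ : Set Y) n := (exists_mem_openCell y).choose

theorem mem_cellOf (y : Y) : y ∈ openCell (cellOf y).1 (cellOf y).2 :=
  (exists_mem_openCell y).choose_spec

theorem cellOf_eq {y : Y} {n : ℕ} {i : cell (univ : Set Y) n} (h : y ∈ openCell n i) :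
    cellOf y = ⟨n, i⟩ := by
  have := eq_of_not_disjoint_openCell (not_disjoint_iff.2 ⟨y, mem_cellOf y, h⟩)
  exact this

theorem cellOf_lt_of_mem_sphere [T2Space Y] {n : ℕ} {i : cell (univ : Set Y) n} {x : Fin n → ℝ}
    (hx : x ∈ sphere (0 : Fin n → ℝ) 1) : (cellOf (map n i x)).1 < n := by
  have h : map n i x ∈ cellFrontier n i := mem_image_of_mem _ hx
  have h' := cellFrontier_subset_skeletonLT n i h
  obtain ⟨m, hm, j, hj⟩ := CWComplex.mem_skeletonLT_iff.1 h'
  rw [cellOf_eq hj]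
  exact_mod_cast hm

/-- A map defined cell by cell: the value at a point of an open `n`-cell is given by an extension
operator applied to the map on the cells of lower dimension. -/
def cellRec {T : Type*} [Nonempty T]
    (ext : ∀ n (_ : cell (univ : Set Y) n), ((Fin n → ℝ) → T) → (Fin n → ℝ) → T) : ℕ → Y → T
  | 0 => fun _ => Classical.arbitrary T
  | n + 1 => fun y =>
      if (cellOf y).1 = n then
        ext _ (cellOf y).2 (fun x => cellRec ext n (map _ (cellOf y).2 x))
          ((map _ (cellOf y).2).symm y)
      else cellRec ext n y

theorem cellRec_succ_self {T : Type*} [Nonempty T]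
    (ext : ∀ n (_ : cell (univ : Set Y) n), ((Fin n → ℝ) → T) → (Fin n → ℝ) → T) (y : Y) :
    cellRec ext ((cellOf y).1 + 1) y =
      ext _ (cellOf y).2 (fun x => cellRec ext (cellOf y).1 (map _ (cellOf y).2 x))
        ((map _ (cellOf y).2).symm y) :=
  if_pos rfl

theorem cellRec_of_lt {T : Type*} [Nonempty T]
    (ext : ∀ n (_ : cell (univ : Set Y) n), ((Fin n → ℝ) → T) → (Fin n → ℝ) → T) (y : Y) (n : ℕ)
    (h : (cellOf y).1 < n) : cellRec ext n y = cellRec ext ((cellOf y).1 + 1) y := by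
  induction n with
  | zero => omega
  | succ n ih =>
    by_cases hn : (cellOf y).1 = n
    · rw [hn]
    · rw [← ih (by omega)]
      exact if_neg hn

variable [T2Space Y]

/-- The characteristic map sends closed subsets of the compact ball to compact, hence closed,
subsets of the Hausdorff space `Y`, so continuity descends from the ball to the closed cell. -/
theorem continuousOn_closedCell {T : Type*} [TopologicalSpace T] {F : Y → T} {n : ℕ}
    {i : cell (univ : Set Y) n} (h : ContinuousOn (fun x => F (map n i x)) (closedBall 0 1)) :
    ContinuousOn F (closedCell n i) := by
  rw [continuousOn_iff_isClosed]
  intro C hC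
  have hcl := h.preimage_isClosed_of_isClosed isClosed_closedBall hC
  have hK : IsCompact (closedBall (0 : Fin n → ℝ) 1 ∩ (fun x => F (map n i x)) ⁻¹' C) :=
    (isCompact_closedBall _ _).of_isClosed_subset hcl inter_subset_left
  refine ⟨map n i '' (closedBall (0 : Fin n → ℝ) 1 ∩ (fun x => F (map n i x)) ⁻¹' C),
    (hK.image_of_continuousOn ((continuousOn n i).mono inter_subset_left)).isClosed, ?_⟩
  ext y
  constructor
  · rintro ⟨hy, x, hx, rfl⟩
    exact ⟨⟨x, ⟨hx, hy⟩, rfl⟩, x, hx, rfl⟩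
  · rintro ⟨⟨x, ⟨hx, hy⟩, rfl⟩, h2⟩
    exact ⟨hy, h2⟩

theorem continuous_of_cells {T : Type*} [TopologicalSpace T] {F : Y → T}
    (h : ∀ n (i : cell (univ : Set Y) n),
      ContinuousOn (fun x => F (map n i x)) (closedBall 0 1)) : Continuous F := by
  rw [continuous_iff_isClosed]
  intro C hC
  rw [CWComplex.closed (univ : Set Y) _ (subset_univ _)]
  intro n i
  rw [inter_comm]
  exact (continuousOn_closedCell (h n i)).preimage_isClosed_of_isClosed isClosed_closedCell hC

/-- Continuous maps out of a CW complex, with a pointwise constraint `R`, can be constructed by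
extending them over the cells one by one. -/
theorem exists_continuous_of_cell_extension {T : Type*} [TopologicalSpace T] [Nonempty T]
    (R : Y → T → Prop)
    (hR : ∀ n (i : cell (univ : Set Y) n) (φ : (Fin n → ℝ) → T), ContinuousOn φ (sphere 0 1) →
      (∀ x ∈ sphere 0 1, R (map n i x) (φ x)) →
      ∃ ψ : (Fin n → ℝ) → T, ContinuousOn ψ (closedBall 0 1) ∧ EqOn ψ φ (sphere 0 1) ∧
        ∀ x ∈ closedBall 0 1, R (map n i x) (ψ x)) :
    ∃ F : C(Y, T), ∀ y, R y (F y) := by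
  -- The hypotheses on `φ` move behind the existential, so that choice yields a total extension
  -- operator as `cellRec` needs.
  have hR' : ∀ n (i : cell (univ : Set Y) n) (φ : (Fin n → ℝ) → T),
      ∃ ψ : (Fin n → ℝ) → T, ContinuousOn φ (sphere 0 1) →
      (∀ x ∈ sphere 0 1, R (map n i x) (φ x)) → ContinuousOn ψ (closedBall 0 1) ∧
      EqOn ψ φ (sphere 0 1) ∧ ∀ x ∈ closedBall 0 1, R (map n i x) (ψ x) := by
    intro n i φ
    by_cases h : ContinuousOn φ (sphere 0 1) ∧ ∀ x ∈ sphere 0 1, R (map n i x) (φ x)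
    · obtain ⟨ψ, hψ⟩ := hR n i φ h.1 h.2
      exact ⟨ψ, fun _ _ => hψ⟩
    · exact ⟨φ, fun h1 h2 => absurd ⟨h1, h2⟩ h⟩
  choose ext hext using hR'
  let F : Y → T := fun y => cellRec ext ((cellOf y).1 + 1) y
  have key : ∀ n (i : cell (univ : Set Y) n),
      ContinuousOn (fun x => F (map n i x)) (closedBall 0 1) ∧
        ∀ x ∈ closedBall 0 1, R (map n i x) (F (map n i x)) := by
    intro n
    induction n using Nat.strong_induction_on with
    | _ n ih =>
    intro i
    let φ : (Fin n → ℝ) → T := fun x => cellRec ext n (map n i x)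
    have hφ : ∀ x ∈ sphere (0 : Fin n → ℝ) 1, φ x = F (map n i x) := fun x hx =>
      cellRec_of_lt ext _ n (cellOf_lt_of_mem_sphere hx)
    have hφR : ∀ x ∈ sphere (0 : Fin n → ℝ) 1, R (map n i x) (φ x) := by
      intro x hx
      rw [hφ x hx]
      have hlt := cellOf_lt_of_mem_sphere (i := i) hx
      have hm := openCell_subset_closedCell _ _ (mem_cellOf (map n i x))
      obtain ⟨z, hz, hzx⟩ := hm
      rw [← hzx]
      exact (ih _ hlt _).2 z hz
    have hφc : ContinuousOn φ (sphere 0 1) := by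
      refine ContinuousOn.congr ?_ hφ
      -- Closure finiteness: the frontier lies in finitely many closed cells of lower dimension, and
      -- continuity on each of these closed sets glues.
      obtain ⟨J, hJ⟩ := CWComplex.cellFrontier_subset_finite_closedCell n i
      have hF : ContinuousOn F (⋃ p : Σ m : Fin n, J m, closedCell p.1.1 p.2.1) :=
        (locallyFinite_of_finite _).continuousOn_iUnion (fun _ => isClosed_closedCell)
          fun p => continuousOn_closedCell (ih p.1.1 p.1.2 p.2.1).1
      refine hF.comp ((continuousOn n i).mono sphere_subset_closedBall) ?_
      intro x hx
      have := hJ (mem_image_of_mem _ hx)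
      simp only [mem_iUnion] at this ⊢
      obtain ⟨m, hm, j, hj, h⟩ := this
      exact ⟨⟨⟨m, hm⟩, ⟨j, hj⟩⟩, h⟩
    obtain ⟨h1, h2, h3⟩ := hext n i φ hφc hφR
    have hEq : EqOn (fun x => F (map n i x)) (ext n i φ) (closedBall 0 1) := by
      intro x hx
      rw [← sphere_union_ball] at hx
      rcases hx with hx | hx
      · exact (hφ x hx).symm.trans (h2 hx).symm
      · have hmem : map n i x ∈ openCell n i := mem_image_of_mem _ hx
        have hsymm : (map n i).symm (map n i x) = x :=
          (map n i).left_inv (by rwa [source_eq])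
        have hc := cellOf_eq hmem
        change cellRec ext ((cellOf (map n i x)).1 + 1) (map n i x) = _
        rw [cellRec_succ_self]
        generalize cellOf (map n i x) = p at hc
        subst hc
        rw [hsymm]
    exact ⟨h1.congr hEq, fun x hx => by
      have := h3 x hx
      rw [← hEq hx] at this
      exact this⟩
  refine ⟨⟨F, continuous_of_cells fun n i => (key n i).1⟩, fun y => ?_⟩
  obtain ⟨z, hz, hzy⟩ := openCell_subset_closedCell _ _ (mem_cellOf y)
  have := (key _ (cellOf y).2).2 z hz
  change R y (F y)
  simpa only [hzy] using this

/-- CW complexes are normal. -/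
theorem normalSpace_of_cwComplex : NormalSpace Y := by
  refine ⟨fun A B hA hB hAB => ?_⟩
  -- A Urysohn function is constructed over the cells; on each ball the Tietze theorem extends the
  -- values prescribed on the sphere and on the preimages of `A` and `B`.
  obtain ⟨F, hF⟩ : ∃ F : C(Y, ℝ), ∀ y, (y ∈ A → F y = 0) ∧ (y ∈ B → F y = 1) := by
    refine exists_continuous_of_cell_extension
      (fun y (t : ℝ) => (y ∈ A → t = 0) ∧ (y ∈ B → t = 1)) ?_
    intro n i φ hφ hφR
    have hcont := continuousOn (C := (univ : Set Y)) n i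
    let A' := closedBall (0 : Fin n → ℝ) 1 ∩ map n i ⁻¹' A
    let B' := closedBall (0 : Fin n → ℝ) 1 ∩ map n i ⁻¹' B
    have hA' : IsClosed A' := hcont.preimage_isClosed_of_isClosed isClosed_closedBall hA
    have hB' : IsClosed B' := hcont.preimage_isClosed_of_isClosed isClosed_closedBall hB
    classical
    let g : (Fin n → ℝ) → ℝ := fun x => if x ∈ A' then 0 else if x ∈ B' then 1 else φ x
    have gA : ∀ x ∈ A', g x = 0 := fun x hx => if_pos hx
    have gB : ∀ x ∈ B', g x = 1 := fun x hx => by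
      have : x ∉ A' := fun h => disjoint_left.1 hAB h.2 hx.2
      simp [g, this, hx]
    have gS : ∀ x ∈ sphere (0 : Fin n → ℝ) 1, g x = φ x := by
      intro x hx
      by_cases h1 : x ∈ A'
      · rw [gA x h1, (hφR x hx).1 h1.2]
      by_cases h2 : x ∈ B'
      · rw [gB x h2, (hφR x hx).2 h2.2]
      simp [g, h1, h2]
    have hS : IsClosed (sphere (0 : Fin n → ℝ) 1) := isClosed_sphere
    have hg : ContinuousOn g (A' ∪ B' ∪ sphere 0 1) := by
      refine ContinuousOn.union_of_isClosed (ContinuousOn.union_of_isClosed ?_ ?_ hA' hB') ?_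
        (hA'.union hB') hS
      · exact continuousOn_const.congr gA
      · exact continuousOn_const.congr gB
      · exact hφ.congr gS
    have hcl : IsClosed (A' ∪ B' ∪ sphere (0 : Fin n → ℝ) 1) := (hA'.union hB').union hS
    obtain ⟨ψ, hψ⟩ := ContinuousMap.exists_restrict_eq hcl
      ⟨_, continuousOn_iff_continuous_domRestrict.1 hg⟩
    have hψ' : ∀ x ∈ A' ∪ B' ∪ sphere (0 : Fin n → ℝ) 1, ψ x = g x := fun x hx =>
      DFunLike.congr_fun hψ ⟨x, hx⟩
    refine ⟨ψ, ψ.continuous.continuousOn, fun x hx => ?_, fun x hx => ⟨fun h => ?_, fun h => ?_⟩⟩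
    · rw [hψ' x (Or.inr hx), gS x hx]
    · rw [hψ' x (Or.inl (Or.inl ⟨hx, h⟩)), gA x ⟨hx, h⟩]
    · rw [hψ' x (Or.inl (Or.inr ⟨hx, h⟩)), gB x ⟨hx, h⟩]
  refine ⟨F ⁻¹' Iio (1 / 2), F ⁻¹' Ioi (1 / 2), isOpen_Iio.preimage F.continuous,
    isOpen_Ioi.preimage F.continuous, fun y hy => ?_, fun y hy => ?_, ?_⟩
  · simp [(hF y).1 hy]
  · simp only [mem_preimage, (hF y).2 hy, mem_Ioi]; norm_num
  · exact Disjoint.preimage _ (by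
      rw [disjoint_left]; intro x h1 h2; exact lt_asymm (mem_Iio.1 h1) (mem_Ioi.1 h2))

/-- Turns a homotopy over a subset into a family of paths; off `S` the path is an irrelevant
constant. -/
theorem exists_curry_continuousOn {A B : Type*} [TopologicalSpace A] [TopologicalSpace B]
    [Nonempty B] {S : Set A} {K : A × I → B} (hK : ContinuousOn K (S ×ˢ univ)) :
    ∃ ψ : A → C(I, B), ContinuousOn ψ S ∧ ∀ x ∈ S, ∀ t, ψ x t = K (x, t) := by
  classical
  have hc : Continuous fun p : S × I => K (p.1, p.2) :=
    hK.comp_continuous (by fun_prop) fun p => ⟨p.1.2, mem_univ _⟩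
  let k : C(S, C(I, B)) := ContinuousMap.curry ⟨_, hc⟩
  refine ⟨fun x => if hx : x ∈ S then k ⟨x, hx⟩ else ContinuousMap.const _ (Classical.arbitrary B),
    ?_, fun x hx t => by simp only [dif_pos hx]; rfl⟩
  rw [continuousOn_iff_continuous_domRestrict]
  convert k.continuous using 1
  ext1 x
  exact dif_pos x.2

/-- A vertex of a CW complex has a neighbourhood that contracts, relative to the vertex, to the
vertex by a deformation of the whole complex. -/
theorem exists_contraction_near_vertex (i₀ : cell (univ : Set Y) 0) (y₀ : Y)
    (h₀ : y₀ ∈ closedCell 0 i₀) :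
    ∃ (v : C(Y, I)) (D : C(Y × I, Y)), v y₀ = 0 ∧ (∀ y, D (y, 0) = y) ∧ (∀ t, D (y₀, t) = y₀) ∧
      ∀ y, v y < 1 → D (y, 1) = y₀ := by
  have : Nonempty Y := ⟨y₀⟩
  -- This is homotopy extension for the vertex, with target `Y × {0} ∪ {y₀} × I`, the complex with a
  -- whisker. At `y₀` the path climbs the whisker, so near `y₀` it ends at positive height, where
  -- its first coordinate must be `y₀`.
  obtain ⟨F, hF⟩ : ∃ F : C(Y, C(I, Y × I)), ∀ y, F y 0 = (y, 0) ∧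
      (∀ t, (F y t).1 = y₀ ∨ (F y t).2 = 0) ∧ (y = y₀ → ∀ t, F y t = (y₀, t)) := by
    refine exists_continuous_of_cell_extension (fun y (γ : C(I, Y × I)) => γ 0 = (y, 0) ∧
      (∀ t, (γ t).1 = y₀ ∨ (γ t).2 = 0) ∧ (y = y₀ → ∀ t, γ t = (y₀, t))) ?_
    intro n i φ hφ hφR
    -- Only a `0`-cell can have `y₀` in its open cell; in positive dimension `y₀` can appear only on
    -- the boundary, where `φ` already climbs the whisker.
    rcases Nat.eq_zero_or_pos n with rfl | hn
    · by_cases h : map 0 i 0 = y₀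
      · refine ⟨fun _ => ⟨fun t => (y₀, t), by fun_prop⟩, continuousOn_const, ?_, ?_⟩
        · intro x hx
          rw [Subsingleton.elim x 0, mem_sphere, dist_self] at hx
          exact absurd hx zero_ne_one
        · intro x _
          rw [Subsingleton.elim x 0, h]
          exact ⟨rfl, fun t => Or.inl rfl, fun _ t => rfl⟩
      · refine ⟨fun _ => ContinuousMap.const _ (map 0 i 0, 0), continuousOn_const, ?_, ?_⟩
        · intro x hx
          rw [Subsingleton.elim x 0, mem_sphere, dist_self] at hx
          exact absurd hx zero_ne_one
        · intro x _
          rw [Subsingleton.elim x 0]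
          exact ⟨rfl, fun t => Or.inr rfl, fun h' => absurd h' h⟩
    · have hcont := continuousOn (C := (univ : Set Y)) n i
      classical
      -- Radial projection of the cylinder from the point `(0, 2)`: the ray through `(x, t)` meets
      -- either the bottom at `2x / (2 - t)` or the side at height `2 - (2 - t) / ‖x‖`.
      let K : (Fin n → ℝ) × I → Y × I := fun p =>
        if 2 * ‖p.1‖ ≤ 2 - (p.2 : ℝ) then (map n i ((2 / (2 - (p.2 : ℝ))) • p.1), 0)
        else φ (‖p.1‖⁻¹ • p.1) (projIcc 0 1 zero_le_one (2 - (2 - (p.2 : ℝ)) / ‖p.1‖))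
      have hpos : ∀ t : I, 0 < 2 - (t : ℝ) := fun t => by linarith [t.2.2]
      have hK1 : ∀ x (t : I), 2 * ‖x‖ ≤ 2 - (t : ℝ) →
          K (x, t) = (map n i ((2 / (2 - (t : ℝ))) • x), 0) := fun x t h => if_pos h
      have hK2 : ∀ x (t : I), 2 - (t : ℝ) ≤ 2 * ‖x‖ → K (x, t) =
          φ (‖x‖⁻¹ • x) (projIcc 0 1 zero_le_one (2 - (2 - (t : ℝ)) / ‖x‖)) := by
        intro x t h
        by_cases h' : 2 * ‖x‖ ≤ 2 - (t : ℝ)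
        · have he : 2 - (t : ℝ) = 2 * ‖x‖ := le_antisymm h h'
          have hx : 0 < ‖x‖ := by linarith [hpos t]
          rw [hK1 x t h', he]
          have h1 : (2 : ℝ) / (2 * ‖x‖) = ‖x‖⁻¹ := by field_simp
          have h2 : (2 : ℝ) - 2 * ‖x‖ / ‖x‖ = 0 := by field_simp; norm_num
          rw [h1, h2, projIcc_left]
          refine ((hφR (‖x‖⁻¹ • x) ?_).1).symm
          simp [norm_smul, hx.ne']
        · exact if_neg h'
      have hKc : ContinuousOn K (closedBall 0 1 ×ˢ univ) := by
        have e : (closedBall (0 : Fin n → ℝ) 1 ×ˢ (univ : Set I)) =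
            {p | p.1 ∈ closedBall 0 1 ∧ 2 * ‖p.1‖ ≤ 2 - (p.2 : ℝ)} ∪
              {p | p.1 ∈ closedBall 0 1 ∧ 2 - (p.2 : ℝ) ≤ 2 * ‖p.1‖} := by
          ext p
          simp only [mem_prod, mem_univ, and_true, mem_union, mem_ofPred_eq, ← and_or_left,
            le_total, and_true]
        rw [e]
        refine ContinuousOn.union_of_isClosed ?_ ?_ ?_ ?_
        · refine ContinuousOn.congr (f := fun p : (Fin n → ℝ) × I =>
            (map n i ((2 / (2 - (p.2 : ℝ))) • p.1), (0 : I))) ?_ fun p hp => hK1 _ _ hp.2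
          refine ContinuousOn.prodMk (hcont.comp (Continuous.continuousOn ?_) ?_) continuousOn_const
          · have hd : Continuous fun p : (Fin n → ℝ) × I => 2 / (2 - (p.2 : ℝ)) :=
              continuous_const.div (by fun_prop) fun p => (hpos p.2).ne'
            exact hd.smul continuous_fst
          · rintro ⟨x, t⟩ ⟨-, h⟩
            simp only [mem_closedBall, dist_zero_right, norm_smul, norm_div] at h ⊢
            rw [Real.norm_of_nonneg (hpos t).le, Real.norm_of_nonneg zero_le_two, div_mul_eq_mul_div,
              div_le_one (hpos t)]
            exact h
        · refine ContinuousOn.congr (f := fun p : (Fin n → ℝ) × I =>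
            φ (‖p.1‖⁻¹ • p.1) (projIcc 0 1 zero_le_one (2 - (2 - (p.2 : ℝ)) / ‖p.1‖))) ?_
            fun p hp => hK2 _ _ hp.2
          have hne : ∀ p ∈ {p : (Fin n → ℝ) × I | p.1 ∈ closedBall 0 1 ∧
              2 - (p.2 : ℝ) ≤ 2 * ‖p.1‖}, ‖p.1‖ ≠ 0 := fun p hp h => by
            have := hp.2
            rw [h] at this
            linarith [hpos p.2]
          have hn' : ContinuousOn (fun p : (Fin n → ℝ) × I => ‖p.1‖)
              {p : (Fin n → ℝ) × I | p.1 ∈ closedBall 0 1 ∧ 2 - (p.2 : ℝ) ≤ 2 * ‖p.1‖} :=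
            Continuous.continuousOn (by fun_prop)
          refine ContinuousOn.eval (hφ.comp (ContinuousOn.smul (hn'.inv₀ hne)
            continuous_fst.continuousOn) ?_) (continuous_projIcc.comp_continuousOn
              (continuousOn_const.sub (ContinuousOn.div (Continuous.continuousOn (by fun_prop))
                hn' hne)))
          intro p hp
          simp [norm_smul, hne p hp]
        · exact (isClosed_closedBall.preimage continuous_fst).inter
            (isClosed_le (f := fun p : (Fin n → ℝ) × I => 2 * ‖p.1‖)
              (g := fun p => 2 - (p.2 : ℝ)) (by fun_prop) (by fun_prop))
        · exact (isClosed_closedBall.preimage continuous_fst).inter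
            (isClosed_le (f := fun p : (Fin n → ℝ) × I => 2 - (p.2 : ℝ))
              (g := fun p => 2 * ‖p.1‖) (by fun_prop) (by fun_prop))
      have hKS : ∀ x ∈ sphere (0 : Fin n → ℝ) 1, ∀ t, K (x, t) = φ x t := by
        intro x hx t
        have hx1 : ‖x‖ = 1 := by simpa using hx
        rw [hK2 x t (by rw [hx1]; linarith [t.2.1]), hx1]
        have : 2 - (2 - (t : ℝ)) / 1 = t := by ring
        rw [this, projIcc_val, inv_one, one_smul]
      obtain ⟨ψ, hψ, hψK⟩ := exists_curry_continuousOn hKc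
      refine ⟨ψ, hψ, fun x hx => ?_, fun x hx => ⟨?_, fun t => ?_, ?_⟩⟩
      · ext1 t
        rw [hψK x (sphere_subset_closedBall hx), hKS x hx]
      · have hx1 : ‖x‖ ≤ 1 := by simpa using hx
        rw [hψK x hx, hK1 x 0 (by simpa using hx1)]
        simp
      · rw [hψK x hx]
        rcases le_total (2 * ‖x‖) (2 - (t : ℝ)) with h | h
        · rw [hK1 x t h]; exact Or.inr rfl
        · rw [hK2 x t h]
          have hx0 : ‖x‖ ≠ 0 := fun h0 => by rw [h0] at h; linarith [hpos t]
          exact (hφR (‖x‖⁻¹ • x) (by simp [norm_smul, hx0])).2.1 _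
      · intro hxy t
        rw [← sphere_union_ball] at hx
        rcases hx with hx | hx
        · rw [hψK x (sphere_subset_closedBall hx), hKS x hx]
          exact (hφR x hx).2.2 hxy t
        · exfalso
          have h1 : y₀ ∈ openCell n i := hxy ▸ mem_image_of_mem _ hx
          have h2 : y₀ ∈ openCell 0 i₀ := by
            rw [openCell_zero_eq_singleton]; rwa [closedCell_zero_eq_singleton] at h₀
          have := congrArg Sigma.fst ((cellOf_eq h1).symm.trans (cellOf_eq h2))
          simp only at this
          omega
  -- `v` is one minus the final height on the whisker and `D` is the motion in `Y`; `v y < 1` means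
  -- positive final height, which forces `D (y, 1) = y₀`.
  refine ⟨⟨fun y => σ (F y 1).2, ?_⟩, ⟨fun p => (F p.1 p.2).1, ?_⟩, ?_, ?_, ?_, ?_⟩
  · exact unitInterval.continuous_symm.comp
      (continuous_snd.comp ((F.continuous).eval continuous_const))
  · exact continuous_fst.comp ((F.continuous.comp continuous_fst).eval continuous_snd)
  · simp [(hF y₀).2.2 rfl 1]
  · intro y
    simp [(hF y).1]
  · intro t
    simp [(hF y₀).2.2 rfl t]
  · intro y hy
    refine ((hF y).2.1 1).resolve_right fun h => ?_
    simp [h] at hy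

end CellularExtension

end LS

/-! ### Numerable covers with null-homotopies, one of them pointed -/

namespace LS

open Topology Metric Set Topology.RelCWComplex

/-- The projection of the real line to the unit interval. -/
def toI (r : ℝ) : I := projIcc 0 1 zero_le_one r

@[fun_prop]
theorem continuous_toI : Continuous toI := continuous_projIcc (h := zero_le_one)

@[simp] theorem toI_coe (t : I) : toI t = t := projIcc_val _ t

theorem toI_of_nonpos {r : ℝ} (h : r ≤ 0) : toI r = 0 := projIcc_of_le_left _ h

theorem toI_of_one_le {r : ℝ} (h : 1 ≤ r) : toI r = 1 := projIcc_of_right_le _ h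

@[simp] theorem toI_zero : toI 0 = 0 := toI_of_nonpos le_rfl

@[simp] theorem toI_one : toI 1 = 1 := toI_of_one_le le_rfl

theorem coe_toI {r : ℝ} (h0 : 0 ≤ r) (h1 : r ≤ 1) : (toI r : ℝ) = r :=
  congrArg Subtype.val (projIcc_of_mem zero_le_one ⟨h0, h1⟩)

/-- The restriction of a map to `U` is null-homotopic iff there is a contraction, given as a
function on the whole space that is continuous over `U`. -/
theorem restrict_homotopic_const_iff {A : Type*} {B : Type*} [TopologicalSpace A]
    [TopologicalSpace B] (f : C(A, B)) (U : Set A) (b : B) :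
    ContinuousMap.Homotopic (f.restrict U) (ContinuousMap.const U b) ↔
      ∃ h : A × I → B, ContinuousOn h (U ×ˢ univ) ∧ ∀ a ∈ U, h (a, 0) = b ∧ h (a, 1) = f a := by
  classical
  constructor
  · rintro ⟨F⟩
    -- Time is reversed, so that `h` runs from the base point to `f`, like the paths in the mapping
    -- fibre.
    refine ⟨fun p => if hp : p.1 ∈ U then F (σ p.2, ⟨p.1, hp⟩) else b, ?_, fun a ha => ?_⟩
    · rw [continuousOn_iff_continuous_domRestrict]
      have hc : Continuous fun q : (U ×ˢ (univ : Set I) : Set (A × I)) =>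
          F (σ q.1.2, ⟨q.1.1, q.2.1⟩) := by fun_prop
      convert hc using 1
      ext q
      exact dif_pos q.2.1
    · simp [ha]
  · rintro ⟨h, hc, hh⟩
    refine ⟨⟨⟨fun p => h (p.2, σ p.1), ?_⟩, fun x => ?_, fun x => ?_⟩⟩
    · exact hc.comp_continuous (by fun_prop) fun p => ⟨p.2.2, mem_univ _⟩
    · simpa using (hh x x.2).2
    · simpa using (hh x x.2).1

/-- A numerable cover of `Y` by the sets `V 0, …, V n` with null-homotopies of `g` on them; the base
point lies in `V 0` only, and the null-homotopy on `V 0` fixes the base point. -/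
structure NullCover {Y X : PointedSpace.{u}} (g : PMap Y X) (n : ℕ) where
  V : ℕ → Set Y
  isOpen : ∀ i, IsOpen (V i)
  eq_empty : ∀ i, n < i → V i = ∅
  bump : ℕ → C(Y, ℝ)
  nonneg : ∀ i y, 0 ≤ bump i y
  le_one : ∀ i y, bump i y ≤ 1
  tsupport_subset : ∀ i, tsupport (bump i) ⊆ V i
  exists_eq_one : ∀ y, ∃ i, bump i y = 1
  H : ℕ → Y × I → X
  continuousOn : ∀ i, ContinuousOn (H i) (V i ×ˢ univ)
  H_zero : ∀ i, ∀ y ∈ V i, H i (y, 0) = X.base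
  H_one : ∀ i, ∀ y ∈ V i, H i (y, 1) = g.toMap y
  base_notMem : ∀ i, i ≠ 0 → Y.base ∉ V i
  H_base : ∀ t, H 0 (Y.base, t) = X.base

/-- At `y₀` the homotopy `h` traces a loop `α`. Prepending the reverse of `α` makes this trace
contractible, and since `D` is constant near `y₀` the contraction can be inserted there, controlled
by the distance function `v`. -/
theorem exists_nullHomotopy_fixing_base {Y X : Type*} [TopologicalSpace Y] [TopologicalSpace X]
    {y₀ : Y} {b : X} {g : Y → X} {v : C(Y, I)} {D : Y → Y} (hD : Continuous D) (hv : v y₀ = 0)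
    (hvD : ∀ y, v y < 1 → D y = y₀) (hg : g y₀ = b) {U : Set Y} (hy₀ : y₀ ∈ U) {h : Y × I → X}
    (hc : ContinuousOn h (U ×ˢ univ)) (h0 : ∀ y ∈ U, h (y, 0) = b) (h1 : ∀ y ∈ U, h (y, 1) = g y) :
    ∃ H : Y × I → X, ContinuousOn H ((D ⁻¹' U) ×ˢ univ) ∧ (∀ y ∈ D ⁻¹' U, H (y, 0) = b) ∧
      (∀ y ∈ D ⁻¹' U, H (y, 1) = g (D y)) ∧ ∀ t, H (y₀, t) = b := by
  classical
  let α : ℝ → X := fun r => h (y₀, toI r)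
  have hα : Continuous α := hc.comp_continuous (by fun_prop) fun r => ⟨hy₀, mem_univ _⟩
  have hα0 : α 0 = b := by simp [α, h0 y₀ hy₀]
  have hα1 : α 1 = b := by simp [α, h1 y₀ hy₀, hg]
  -- `K₂` is reversed `α` followed by `h` along `D`. `K₁` travels only a fraction `θ` of the way
  -- back along `α` and then returns: it is constant at `y₀`, where `θ = 0`, and equals `K₂` for
  -- `1/2 < v < 1`, where `θ = 1`.
  let θ : Y → ℝ := fun y => min 1 (2 * (v y : ℝ))
  let K₁ : Y × I → X := fun p => α (1 - 2 * min (p.2 : ℝ) (1 - p.2) * θ p.1)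
  let K₂ : Y × I → X := fun p =>
    if (p.2 : ℝ) ≤ 1 / 2 then α (1 - 2 * p.2) else h (D p.1, toI (2 * p.2 - 1))
  let H : Y × I → X := fun p => if v p.1 < 1 then K₁ p else K₂ p
  have hK₁ : Continuous K₁ := by fun_prop
  have hK₂ : ContinuousOn K₂ ((D ⁻¹' U) ×ˢ univ) := by
    refine ContinuousOn.if ?_ ?_ ?_
    · rintro ⟨y, t⟩ ⟨⟨hy, -⟩, ht⟩
      have : (t : ℝ) = 1 / 2 := by
        have := frontier_le_subset_eq (f := fun p : Y × I => (p.2 : ℝ)) (g := fun _ => 1 / 2)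
          (by fun_prop) (by fun_prop) ht
        exact this
      simp only [this]
      norm_num
      rw [h0 _ hy, hα0]
    · exact (hα.comp (by fun_prop)).continuousOn
    · refine hc.comp (Continuous.continuousOn (by fun_prop)) ?_
      rintro ⟨y, t⟩ ⟨⟨hy, -⟩, -⟩
      exact ⟨hy, mem_univ _⟩
  have hK₁₂ : ∀ p : Y × I, v p.1 < 1 → (1 / 2 : ℝ) < v p.1 → K₁ p = K₂ p := by
    rintro ⟨y, t⟩ hy1 hy2
    have hθ : θ y = 1 := min_eq_left (by simp only at hy2; linarith)
    simp only [K₁, K₂, hθ, mul_one]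
    split_ifs with ht
    · rw [min_eq_left (by linarith)]
    · rw [min_eq_right (by linarith), hvD y hy1]
      simp only [α]
      congr 3
      ring
  refine ⟨H, ?_, fun y hy => ?_, fun y hy => ?_, fun t => ?_⟩
  · rintro ⟨y, t⟩ hy
    have hvc : Continuous fun p : Y × I => v p.1 := by fun_prop
    by_cases hv1 : v y < 1
    · refine (hK₁.continuousAt.congr ?_).continuousWithinAt
      filter_upwards [(isOpen_Iio.preimage hvc).mem_nhds hv1] with p hp
      exact (if_pos hp).symm
    · have hv2 : (1 / 2 : ℝ) < v y := by
        have : v y = 1 := le_antisymm unitInterval.le_one' (not_lt.1 hv1)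
        rw [this]; norm_num
      have hvc' : Continuous fun p : Y × I => (v p.1 : ℝ) := by fun_prop
      refine (hK₂ _ hy).congr_of_eventuallyEq_of_mem ?_ hy
      refine Filter.Eventually.filter_mono nhdsWithin_le_nhds ?_
      filter_upwards [(isOpen_Ioi.preimage hvc').mem_nhds hv2] with p hp
      by_cases h : v p.1 < 1
      · exact (if_pos h).trans (hK₁₂ p h hp)
      · exact if_neg h
  · simp only [H, K₁, K₂]
    split_ifs with h2 h3
    · simp [hα1]
    · simp [hα1]
    · norm_num at h3
  · simp only [H, K₁, K₂]
    split_ifs with h2 h3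
    · simp [hα1, hvD y h2, hg]
    · norm_num at h3
    · norm_num
      exact h1 _ hy
  · have hθ : θ y₀ = 0 := by simp [θ, hv]
    simp [H, hv, K₁, hθ, hα1]

/-- Precomposing `g` with the end of the deformation near the vertex changes it only by a pointed
homotopy and makes room to correct one null-homotopy at the base point. Normality then supplies the
bump functions. -/
theorem exists_nullCover {Y X : PointedSpace.{u}} (hY : IsPointedCW Y) (g : PMap Y X) {n : ℕ}
    (U : Fin (n + 1) → Set Y) (hU : ∀ i, IsOpen (U i)) (hcov : ⋃ i, U i = univ)
    (hnull : ∀ i, ContinuousMap.Homotopic (g.toMap.restrict (U i))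
      (ContinuousMap.const (U i) X.base)) :
    ∃ g' : PMap Y X, g.Homotopic g' ∧ Nonempty (NullCover g' n) := by
  obtain ⟨hT2, hCW, i₀, hi₀⟩ := hY
  have : NormalSpace Y := normalSpace_of_cwComplex
  obtain ⟨v, D, hv, hD0, hDb, hvD⟩ := exists_contraction_near_vertex i₀ Y.base hi₀
  let D₁ : C(Y, Y) := ⟨fun y => D (y, 1), by fun_prop⟩
  have hD₁ : D₁ Y.base = Y.base := hDb 1
  let g' : PMap Y X := ⟨g.toMap.comp D₁, by simp [hD₁, g.map_base]⟩
  refine ⟨g', ⟨⟨⟨⟨fun p => g.toMap (D (p.2, p.1)), by fun_prop⟩, fun y => ?_, fun y => ?_⟩, ?_⟩⟩, ?_⟩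
  · simp [hD0]
  · rfl
  · rintro t y (rfl : y = Y.base)
    simp [hDb]
  obtain ⟨j, hj⟩ : ∃ j, Y.base ∈ U j :=
    mem_iUnion.1 (hcov ▸ mem_univ Y.base : Y.base ∈ ⋃ i, U i)
  -- Renumbering puts a member containing the base point at index `0`; the base point is then
  -- deleted from all the others, so only that null-homotopy needs correcting.
  let e : Fin (n + 1) ≃ Fin (n + 1) := Equiv.swap 0 j
  choose h hc hh using fun i => (restrict_homotopic_const_iff g.toMap (U i) X.base).1 (hnull i)
  have hj' : Y.base ∈ U (e 0) := by simpa [e] using hj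
  obtain ⟨H₀, hH₀c, hH₀0, hH₀1, hH₀b⟩ := exists_nullHomotopy_fixing_base D₁.continuous hv hvD
    g.map_base hj' (hc (e 0)) (fun y hy => (hh _ y hy).1) (fun y hy => (hh _ y hy).2)
  classical
  let V : ℕ → Set Y := fun i => if hi : i < n + 1 then
    (if i = 0 then D₁ ⁻¹' U (e ⟨i, hi⟩) else D₁ ⁻¹' U (e ⟨i, hi⟩) \ {Y.base}) else ∅
  have hV0 : V 0 = D₁ ⁻¹' U (e 0) := by simp [V]
  have hVs : ∀ i (hi : i < n + 1), i ≠ 0 → V i = D₁ ⁻¹' U (e ⟨i, hi⟩) \ {Y.base} :=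
    fun i hi h0 => (dif_pos hi).trans (if_neg h0)
  have hVe : ∀ i, ¬ i < n + 1 → V i = ∅ := fun i hi => dif_neg hi
  have hVo : ∀ i, IsOpen (V i) := by
    intro i
    by_cases hi : i < n + 1
    · by_cases h0 : i = 0
      · rw [h0, hV0]; exact (hU _).preimage D₁.continuous
      · rw [hVs i hi h0]
        exact ((hU _).preimage D₁.continuous).sdiff isClosed_singleton
    · rw [hVe i hi]; exact isOpen_empty
  have hVb : ∀ i, i ≠ 0 → Y.base ∉ V i := by
    intro i h0
    by_cases hi : i < n + 1
    · rw [hVs i hi h0]; simp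
    · rw [hVe i hi]; simp
  have hVfin : LocallyFinite V := by
    intro y
    refine ⟨univ, Filter.univ_mem, (finite_Iio (n + 1)).subset ?_⟩
    rintro i ⟨z, hz, -⟩
    by_contra hi
    rw [hVe i hi] at hz
    exact hz
  have hVcov : (univ : Set Y) ⊆ ⋃ i, V i := by
    intro y _
    by_cases hy : y = Y.base
    · refine mem_iUnion.2 ⟨0, ?_⟩
      rw [hV0, mem_preimage, hy, hD₁]
      exact hj'
    · obtain ⟨i, hi⟩ : ∃ i, D₁ y ∈ U i :=
        mem_iUnion.1 (hcov ▸ mem_univ (D₁ y) : D₁ y ∈ ⋃ i, U i)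
      refine mem_iUnion.2 ⟨(e.symm i : Fin (n + 1)), ?_⟩
      by_cases h0 : ((e.symm i : Fin (n + 1)) : ℕ) = 0
      · have : e.symm i = 0 := Fin.ext h0
        rw [h0, hV0, ← this]
        simpa using hi
      · rw [hVs _ (e.symm i).2 h0]
        exact ⟨by simpa using hi, hy⟩
  obtain ⟨ρ, hρ⟩ := BumpCovering.exists_isSubordinate_of_locallyFinite isClosed_univ V hVo hVfin hVcov
  let H : ℕ → Y × I → X := fun i p => if i = 0 then H₀ p else
    if hi : i < n + 1 then h (e ⟨i, hi⟩) (D₁ p.1, p.2) else X.base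
  have hH0 : H 0 = H₀ := by ext p; simp [H]
  have hHs : ∀ i (hi : i < n + 1), i ≠ 0 → H i = fun p => h (e ⟨i, hi⟩) (D₁ p.1, p.2) :=
    fun i hi h0 => by
      ext p
      exact (if_neg h0).trans (dif_pos hi)
  refine ⟨⟨V, hVo, fun i hi => hVe i (by omega), fun i => ρ i, fun i => ρ.nonneg i,
    fun i => ρ.le_one i, hρ, fun y => ⟨ρ.ind y (mem_univ y), ρ.ind_apply y (mem_univ y)⟩, H, ?_, ?_,
    ?_, hVb, fun t => by rw [hH0]; exact hH₀b t⟩⟩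
  · intro i
    by_cases h0 : i = 0
    · subst h0; rwa [hH0, hV0]
    by_cases hi : i < n + 1
    · rw [hHs i hi h0, hVs i hi h0]
      refine (hc _).comp (Continuous.continuousOn (by fun_prop)) ?_
      rintro ⟨y, t⟩ ⟨hy, -⟩
      exact ⟨hy.1, mem_univ _⟩
    · rw [hVe i hi, empty_prod]
      exact continuousOn_empty _
  · intro i y hy
    by_cases h0 : i = 0
    · subst h0; rw [hH0]; exact hH₀0 y (hV0 ▸ hy)
    by_cases hi : i < n + 1
    · rw [hVs i hi h0] at hy
      rw [hHs i hi h0]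
      exact (hh _ _ hy.1).1
    · rw [hVe i hi] at hy
      exact hy.elim
  · intro i y hy
    by_cases h0 : i = 0
    · subst h0; rw [hH0]; exact hH₀1 y (hV0 ▸ hy)
    by_cases hi : i < n + 1
    · rw [hVs i hi h0] at hy
      rw [hHs i hi h0]
      exact (hh _ _ hy.1).2
    · rw [hVe i hi] at hy
      exact hy.elim

end LS

/-! ### Pointed homotopies, compression of the diagonal, and lifts to the Ganea stages -/

namespace LS

open Topology Metric Set

namespace PMap

variable {X Y Z W : PointedSpace.{u}}

theorem Homotopic.refl (f : PMap X Y) : f.Homotopic f := ContinuousMap.HomotopicRel.refl _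

theorem Homotopic.symm {f g : PMap X Y} (h : f.Homotopic g) : g.Homotopic f :=
  ContinuousMap.HomotopicRel.symm h

theorem Homotopic.trans {f g k : PMap X Y} (h : f.Homotopic g) (h' : g.Homotopic k) :
    f.Homotopic k :=
  ContinuousMap.HomotopicRel.trans h h'

/-- A pointed homotopy given by a continuous function. -/
theorem Homotopic.of_continuous {f g : PMap X Y} (K : X × I → Y) (hK : Continuous K)
    (h0 : ∀ x, K (x, 0) = f.toMap x) (h1 : ∀ x, K (x, 1) = g.toMap x)
    (hb : ∀ t, K (X.base, t) = Y.base) : f.Homotopic g :=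
  ⟨⟨⟨⟨fun p => K (p.2, p.1), by fun_prop⟩, h0, h1⟩, by
    rintro t x (rfl : x = X.base)
    exact (hb t).trans f.map_base.symm⟩⟩

theorem Homotopic.exists_continuous {f g : PMap X Y} (h : f.Homotopic g) :
    ∃ K : X × I → Y, Continuous K ∧ (∀ x, K (x, 0) = f.toMap x) ∧ (∀ x, K (x, 1) = g.toMap x) ∧
      ∀ t, K (X.base, t) = Y.base := by
  obtain ⟨F⟩ := h
  refine ⟨fun p => F (p.2, p.1), by fun_prop, fun x => F.apply_zero x, fun x => F.apply_one x,
    fun t => ?_⟩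
  exact (F.eq_fst t (mem_singleton _)).trans f.map_base

theorem Homotopic.comp_left {f g : PMap X Y} (h : f.Homotopic g) (k : PMap Y Z) :
    (k.comp f).Homotopic (k.comp g) := by
  obtain ⟨K, hK, h0, h1, hb⟩ := h.exists_continuous
  refine .of_continuous (fun p => k.toMap (K p)) (by fun_prop) (fun x => ?_) (fun x => ?_)
    fun t => ?_
  · simp [h0, comp]
  · simp [h1, comp]
  · simp [hb, k.map_base]

theorem Homotopic.comp_right {f g : PMap Y Z} (h : f.Homotopic g) (k : PMap X Y) :
    (f.comp k).Homotopic (g.comp k) := by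
  obtain ⟨K, hK, h0, h1, hb⟩ := h.exists_continuous
  refine .of_continuous (fun p => K (k.toMap p.1, p.2)) (by fun_prop) (fun x => ?_) (fun x => ?_)
    fun t => ?_
  · simp [h0, comp]
  · simp [h1, comp]
  · simp [hb, k.map_base]

theorem comp_assoc (h : PMap Z W) (g : PMap Y Z) (f : PMap X Y) :
    (h.comp g).comp f = h.comp (g.comp f) := rfl

@[simp] theorem comp_id (f : PMap X Y) : f.comp (id X) = f := rfl

@[simp] theorem comp_const (g : PMap Y Z) : g.comp (const X Y) = const X Z := by
  ext x
  exact g.map_base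

end PMap

/-- A point in the fat wedge represents the base point of the smash power. -/
theorem smashPower_mk_eq_base {X : PointedSpace.{u}} {k : ℕ} (hk : 1 ≤ k) {x : Fin k → X}
    (hx : x ∈ fatWedge X k) :
    (Quotient.mk (collapseSetoid (fatWedge X k)) x : smashPower X k) = (smashPower X k).base :=
  Quotient.sound (Or.inr ⟨hx, ⟨0, hk⟩, rfl⟩)

namespace NullCover

variable {Y X : PointedSpace.{u}} {g : PMap Y X} {n : ℕ} (N : NullCover g n)

include N in
-- Coordinate `i` is contracted over `V i` by the amount `bump i`. At the end some bump equals `1`,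
-- with index at most `n < k`, so that coordinate is at the base point. Coordinate `0` keeps the
-- homotopy pointed.
theorem reducedDiagonal_comp_homotopic_const {k : ℕ} (hk : n < k) :
    ((reducedDiagonal X k).comp g).Homotopic (PMap.const Y (smashPower X k)) := by
  classical
  let W : ℕ → Y × I → X := fun i p =>
    if p.1 ∈ N.V i then N.H i (p.1, toI (1 - p.2 * N.bump i p.1)) else g.toMap p.1
  have hW : ∀ i, Continuous (W i) := by
    intro i
    rw [continuous_iff_continuousAt]
    rintro ⟨y, t⟩
    by_cases hy : y ∈ N.V i
    · have ho : IsOpen (N.V i ×ˢ (univ : Set I)) := (N.isOpen i).prod isOpen_univ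
      refine ContinuousOn.continuousAt (s := N.V i ×ˢ univ) ?_ (ho.mem_nhds ⟨hy, mem_univ _⟩)
      refine ContinuousOn.congr (f := fun p => N.H i (p.1, toI (1 - p.2 * N.bump i p.1)))
        ((N.continuousOn i).comp (Continuous.continuousOn (by fun_prop)) ?_) ?_
      · exact fun p hp => ⟨hp.1, mem_univ _⟩
      · exact fun p hp => if_pos hp.1
    · have ho : IsOpen ((tsupport (N.bump i))ᶜ ×ˢ (univ : Set I)) :=
        (isClosed_tsupport _).isOpen_compl.prod isOpen_univ
      refine ContinuousOn.continuousAt (s := (tsupport (N.bump i))ᶜ ×ˢ univ) ?_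
        (ho.mem_nhds ⟨fun h => hy (N.tsupport_subset i h), mem_univ _⟩)
      refine ContinuousOn.congr (f := fun p => g.toMap p.1)
        (Continuous.continuousOn (by fun_prop)) ?_
      rintro ⟨z, s⟩ ⟨hz, -⟩
      simp only [W]
      split_ifs with h
      · rw [image_eq_zero_of_notMem_tsupport hz]
        simp [N.H_one i z h]
      · rfl
  refine .of_continuous (fun p => (Quotient.mk (collapseSetoid (fatWedge X k))
    (fun i : Fin k => W i p) : smashPower X k)) ?_ (fun y => ?_) (fun y => ?_) fun t => ?_
  · exact continuous_quotient_mk'.comp (continuous_pi fun i => hW i)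
  · refine congrArg (Quotient.mk _) (funext fun i => ?_)
    simp only [W]
    split_ifs with h
    · simp [N.H_one i y h]
    · rfl
  · refine smashPower_mk_eq_base (by omega) ?_
    obtain ⟨i, hi⟩ := N.exists_eq_one y
    have hy : y ∈ N.V i := N.tsupport_subset i (subset_tsupport _ (by simp [hi]))
    have hin : i ≤ n := by
      by_contra h
      rw [N.eq_empty i (by omega)] at hy
      exact hy
    refine ⟨⟨i, by omega⟩, ?_⟩
    simp [W, hy, hi, N.H_zero i y hy]
  · refine smashPower_mk_eq_base (by omega) ⟨⟨0, by omega⟩, ?_⟩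
    simp only [W]
    split_ifs with h
    · exact N.H_base _
    · exact g.map_base

include N in
theorem bump_base_zero : N.bump 0 Y.base = 1 := by
  obtain ⟨i, hi⟩ := N.exists_eq_one Y.base
  rcases eq_or_ne i 0 with rfl | h
  · exact hi
  · exact absurd (N.tsupport_subset i (subset_tsupport _ (by simp [hi]))) (N.base_notMem i h)

include N in
theorem bump_base_of_ne {i : ℕ} (hi : i ≠ 0) : N.bump i Y.base = 0 :=
  image_eq_zero_of_notMem_tsupport fun h => N.base_notMem i hi (N.tsupport_subset i h)

end NullCover

/-- The lift of a map `g` to one more stage of the fibre-cofibre construction: a lift up to homotopy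
over the open set `0 < μ` and a null-homotopy over the open set `0 < l` combine to a lift up to
homotopy, to the next stage, over their union. -/
theorem exists_lift_ganeaStep {X : PointedSpace.{u}} (S : SpaceOver X) {Y : PointedSpace.{u}}
    (g : Y → X) (μ l : C(Y, ℝ)) (hμ : ∀ y, 0 ≤ μ y) (hl : ∀ y, 0 ≤ l y)
    (s : Y → S.space) (K : Y × I → X) (hs : ContinuousOn s {y | 0 < μ y})
    (hK : ContinuousOn K ({y | 0 < μ y} ×ˢ univ)) (hK0 : ∀ y, 0 < μ y → K (y, 0) = S.map.toMap (s y))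
    (hK1 : ∀ y, 0 < μ y → K (y, 1) = g y)
    (H : Y × I → X) (hH : ContinuousOn H ({y | 0 < l y} ×ˢ univ))
    (hH0 : ∀ y, 0 < l y → H (y, 0) = X.base) (hH1 : ∀ y, 0 < l y → H (y, 1) = g y) :
    ∃ (s' : Y → (ganeaStep S).space) (K' : Y × I → X),
      ContinuousOn s' {y | 0 < μ y + l y} ∧ ContinuousOn K' ({y | 0 < μ y + l y} ×ˢ univ) ∧
      (∀ y, 0 < μ y + l y → K' (y, 0) = (ganeaStep S).map.toMap (s' y)) ∧
      (∀ y, 0 < μ y + l y → K' (y, 1) = g y) ∧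
      ∀ y, l y < μ y → s' y = Quot.mk _ (Sum.inl (s y)) ∧ ∀ t, K' (y, t) = K (y, t) := by
  classical
  have : Nonempty X := ⟨X.base⟩
  let O : Set Y := {y | 0 < μ y ∧ 0 < l y}
  have hO : IsOpen O := (isOpen_lt continuous_const μ.continuous).inter
    (isOpen_lt continuous_const l.continuous)
  -- The null-homotopy from the base point to `g y`, then the lifting homotopy backwards to the
  -- image of `s y`: with `s y` this is a point of the mapping fibre. The midpoint of the path is `g
  -- y`.
  let Γ : Y × I → X := fun p =>
    if (p.2 : ℝ) ≤ 1 / 2 then H (p.1, toI (2 * p.2)) else K (p.1, toI (2 - 2 * p.2))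
  have hΓ : ContinuousOn Γ (O ×ˢ univ) := by
    refine ContinuousOn.if ?_ ?_ ?_
    · rintro ⟨y, t⟩ ⟨⟨hy, -⟩, ht⟩
      have : (t : ℝ) = 1 / 2 := frontier_le_subset_eq (f := fun p : Y × I => (p.2 : ℝ))
        (g := fun _ => 1 / 2) (by fun_prop) (by fun_prop) ht
      simp only [this]
      norm_num
      rw [hH1 y hy.2, hK1 y hy.1]
    · refine hH.comp (Continuous.continuousOn (by fun_prop)) ?_
      exact fun p hp => ⟨hp.1.1.2, mem_univ _⟩
    · refine hK.comp (Continuous.continuousOn (by fun_prop)) ?_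
      exact fun p hp => ⟨hp.1.1.1, mem_univ _⟩
  have hΓ1 : ∀ y ∈ O, ∀ t : I, (1 / 2 : ℝ) ≤ t → Γ (y, t) = K (y, toI (2 - 2 * t)) := by
    intro y hy t ht
    rcases ht.eq_or_lt with ht | ht
    · simp only [Γ, ← ht]
      norm_num
      rw [hH1 y hy.2, hK1 y hy.1]
    · exact if_neg (not_le.2 ht)
  have hΓ0 : ∀ y, ∀ t : I, (t : ℝ) ≤ 1 / 2 → Γ (y, t) = H (y, toI (2 * t)) := fun y t ht => if_pos ht
  obtain ⟨γ, hγ, hγΓ⟩ := exists_curry_continuousOn hΓ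
  have hγ0 : ∀ y ∈ O, γ y 0 = X.base := fun y hy => by
    rw [hγΓ y hy, hΓ0 y 0 (by norm_num)]; simp [hH0 y hy.2]
  have hγ1 : ∀ y ∈ O, γ y 1 = S.map.toMap (s y) := fun y hy => by
    rw [hγΓ y hy, hΓ1 y hy 1 (by norm_num)]; simp [hK0 y hy.1]
  -- The cone coordinate, clipped to the interval: it is `1` (the old lift) when `l ≤ μ` and `0`
  -- (the vertex) when `2μ ≤ l`.
  let τ : Y → I := fun y => toI (2 * (2 * μ y - l y) / (μ y + l y))
  have hτ : ContinuousOn τ O := by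
    refine continuous_toI.comp_continuousOn (ContinuousOn.div (Continuous.continuousOn (by fun_prop))
      (Continuous.continuousOn (by fun_prop)) fun y hy => (add_pos hy.1 hy.2).ne')
  have hτ1 : ∀ y ∈ O, l y < μ y → τ y = 1 := fun y hy h =>
    toI_of_one_le (by rw [le_div_iff₀ (add_pos hy.1 hy.2)]; linarith)
  have hτ0 : ∀ y ∈ O, 2 * μ y < l y → τ y = 0 := fun y hy h =>
    toI_of_nonpos (div_nonpos_of_nonpos_of_nonneg (by linarith) (add_pos hy.1 hy.2).le)
  let z₀ : MappingFibre S.map :=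
    ⟨(S.space.base, ContinuousMap.const _ X.base), rfl, S.map.map_base.symm⟩
  let vtx : (ganeaStep S).space := Quot.mk _ (Sum.inr (z₀, 0))
  let c : Y → (ganeaStep S).space := fun y =>
    if h : y ∈ O then Quot.mk _ (Sum.inr (⟨(s y, γ y), hγ0 y h, hγ1 y h⟩, τ y)) else vtx
  have hc : ∀ y (h : y ∈ O),
      c y = Quot.mk _ (Sum.inr (⟨(s y, γ y), hγ0 y h, hγ1 y h⟩, τ y)) := fun y h => dif_pos h
  have hcc : ContinuousOn c O := by
    rw [continuousOn_iff_continuous_domRestrict]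
    have h1 : Continuous fun y : O => s y :=
      continuousOn_iff_continuous_domRestrict.1 (hs.mono fun y hy => hy.1)
    have h2 : Continuous fun y : O => γ y := continuousOn_iff_continuous_domRestrict.1 hγ
    have h3 : Continuous fun y : O => τ y := continuousOn_iff_continuous_domRestrict.1 hτ
    have h4 : Continuous fun y : O =>
        ((⟨(s y, γ y), hγ0 y y.2, hγ1 y y.2⟩ : MappingFibre S.map), τ y) :=
      (Continuous.subtype_mk (h1.prodMk h2) _).prodMk h3
    have h5 : Continuous fun y : O => (Quot.mk _ (Sum.inr
        ((⟨(s y, γ y), hγ0 y y.2, hγ1 y y.2⟩ : MappingFibre S.map), τ y)) :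
          MappingCone (MappingFibre.proj S.map)) :=
      continuous_quot_mk.comp (continuous_inr.comp h4)
    exact h5.congr fun y => (hc y y.2).symm
  let s' : Y → (ganeaStep S).space := fun y =>
    if l y < μ y then Quot.mk _ (Sum.inl (s y)) else if 2 * μ y < l y then vtx else c y
  -- The new lift maps to `Γ` at parameter `τ`, and sliding the parameter linearly to `1/2` reaches
  -- `g`. For `τ = 1` this is exactly `K`, for `τ = 0` exactly `H`, so the three definitions match
  -- on overlaps.
  let L : Y × I → X := fun p => Γ (p.1, toI ((1 - p.2) * τ p.1 + p.2 / 2))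
  have hL : ContinuousOn L (O ×ˢ univ) := by
    refine hΓ.comp (continuousOn_fst.prodMk (continuous_toI.comp_continuousOn ?_))
      fun p hp => ⟨hp.1, mem_univ _⟩
    have : ContinuousOn (fun p : Y × I => (τ p.1 : ℝ)) (O ×ˢ univ) :=
      continuous_subtype_val.comp_continuousOn (hτ.comp continuousOn_fst fun p hp => hp.1)
    exact (ContinuousOn.mul (Continuous.continuousOn (by fun_prop)) this).add
      (Continuous.continuousOn (by fun_prop))
  let K' : Y × I → X := fun p =>
    if l p.1 < μ p.1 then K p else if 2 * μ p.1 < l p.1 then H p else L p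
  have hs'1 : ∀ y, l y < μ y → s' y = Quot.mk _ (Sum.inl (s y)) := fun y h => if_pos h
  have hs'0 : ∀ y, 2 * μ y < l y → s' y = vtx := fun y h =>
    (if_neg (by linarith [hμ y])).trans (if_pos h)
  have hs'O : ∀ y ∈ O, s' y = c y := by
    intro y hy
    by_cases h1 : l y < μ y
    · rw [hs'1 y h1, hc y hy, hτ1 y hy h1]
      exact (Quot.sound (ConeRel.glue (p := MappingFibre.proj S.map)
        ⟨(s y, γ y), hγ0 y hy, hγ1 y hy⟩)).symm
    by_cases h0 : 2 * μ y < l y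
    · rw [hs'0 y h0, hc y hy, hτ0 y hy h0]
      exact Quot.sound (ConeRel.vertex _ _)
    · exact (if_neg h1).trans (if_neg h0)
  have hK'1 : ∀ y, l y < μ y → ∀ t, K' (y, t) = K (y, t) := fun y h t => if_pos h
  have hK'0 : ∀ y, 2 * μ y < l y → ∀ t, K' (y, t) = H (y, t) := fun y h t =>
    (if_neg (by simp only; linarith [hμ y])).trans (if_pos h)
  have hK'O : ∀ y ∈ O, ∀ t, K' (y, t) = L (y, t) := by
    intro y hy t
    simp only [K']
    split_ifs with h1 h0
    · simp only [L, hτ1 y hy h1]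
      have e : (1 - (t : ℝ)) * ((1 : I) : ℝ) + t / 2 = 1 - t / 2 := by simp; ring
      have e' : ((toI (1 - (t : ℝ) / 2)) : ℝ) = 1 - t / 2 :=
        coe_toI (by linarith [t.2.2]) (by linarith [t.2.1])
      rw [e, hΓ1 y hy _ (by rw [e']; linarith [t.2.2]), e']
      have : 2 - 2 * (1 - (t : ℝ) / 2) = t := by ring
      rw [this, toI_coe]
    · simp only [L, hτ0 y hy h0]
      have e : (1 - (t : ℝ)) * ((0 : I) : ℝ) + t / 2 = t / 2 := by simp
      have e' : ((toI ((t : ℝ) / 2)) : ℝ) = t / 2 :=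
        coe_toI (by linarith [t.2.1]) (by linarith [t.2.2])
      rw [e, hΓ0 y _ (by rw [e']; linarith [t.2.2]), e']
      have : 2 * ((t : ℝ) / 2) = t := by ring
      rw [this, toI_coe]
    · rfl
  have hcases : ∀ y, 0 < μ y + l y → l y < μ y ∨ 2 * μ y < l y ∨ y ∈ O := by
    intro y hy
    by_contra! h
    exact h.2.2 ⟨by linarith [hμ y, hl y], by linarith [hμ y, hl y]⟩
  have hW1 : IsOpen {y | l y < μ y} := isOpen_lt l.continuous μ.continuous
  have hW0 : IsOpen {y | 2 * μ y < l y} := isOpen_lt (by fun_prop) l.continuous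
  refine ⟨s', K', ?_, ?_, ?_, ?_, fun y hy => ⟨hs'1 y hy, hK'1 y hy⟩⟩
  · intro y hy
    refine ContinuousAt.continuousWithinAt ?_
    rcases hcases y hy with h | h | h
    · refine ContinuousOn.continuousAt (s := {y | l y < μ y}) ?_ (hW1.mem_nhds h)
      refine ContinuousOn.congr ?_ hs'1
      exact (continuous_quot_mk.comp continuous_inl).comp_continuousOn
        (hs.mono fun y hy => (hl y).trans_lt hy)
    · refine ContinuousOn.continuousAt (s := {y | 2 * μ y < l y}) ?_ (hW0.mem_nhds h)
      exact continuousOn_const.congr hs'0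
    · exact ContinuousOn.continuousAt (hcc.congr hs'O) (hO.mem_nhds h)
  · rintro ⟨y, t⟩ ⟨hy, -⟩
    refine ContinuousAt.continuousWithinAt ?_
    rcases hcases y hy with h | h | h
    · refine ContinuousOn.continuousAt (s := {y | l y < μ y} ×ˢ univ) ?_
        ((hW1.prod isOpen_univ).mem_nhds ⟨h, mem_univ _⟩)
      refine ContinuousOn.congr ?_ fun p hp => hK'1 p.1 hp.1 p.2
      exact hK.mono fun p hp => ⟨(hl p.1).trans_lt hp.1, mem_univ _⟩
    · refine ContinuousOn.continuousAt (s := {y | 2 * μ y < l y} ×ˢ univ) ?_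
        ((hW0.prod isOpen_univ).mem_nhds ⟨h, mem_univ _⟩)
      refine ContinuousOn.congr ?_ fun p hp => hK'0 p.1 hp.1 p.2
      refine hH.mono fun p hp => ⟨?_, mem_univ _⟩
      have h1 : 2 * μ p.1 < l p.1 := hp.1
      have h2 := hμ p.1
      change 0 < l p.1
      linarith
    · refine ContinuousOn.continuousAt (s := O ×ˢ univ) ?_
        ((hO.prod isOpen_univ).mem_nhds ⟨h, mem_univ _⟩)
      exact hL.congr fun p hp => hK'O p.1 hp.1 p.2
  · intro y hy
    rcases hcases y hy with h | h | h
    · rw [hK'1 y h, hs'1 y h, hK0 y ((hl y).trans_lt h)]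
      rfl
    · rw [hK'0 y h, hs'0 y h, hH0 y (by linarith [hμ y])]
      rfl
    · rw [hK'O y h, hs'O y h, hc y h]
      change _ = γ y (τ y)
      rw [hγΓ y h]
      simp [L]
  · intro y hy
    rcases hcases y hy with h | h | h
    · rw [hK'1 y h, hK1 y ((hl y).trans_lt h)]
    · rw [hK'0 y h, hH1 y (by linarith [hμ y])]
    · rw [hK'O y h]
      have e : (1 - ((1 : I) : ℝ)) * (τ y) + ((1 : I) : ℝ) / 2 = 1 / 2 := by simp
      have e' : ((toI (1 / 2)) : ℝ) = 1 / 2 := coe_toI (by norm_num) (by norm_num)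
      simp only [L]
      rw [e, hΓ0 y _ e'.le, e']
      norm_num
      exact hH1 y h.2

namespace NullCover

variable {Y X : PointedSpace.{u}} {g : PMap Y X} {n : ℕ} (N : NullCover g n)

include N in
-- Each further member of the cover costs one Ganea stage. The initial null-homotopy is a lift to
-- the point `P⁰`, and the sum of the bumps used so far measures the domain of the lift.
theorem exists_partial_lift (m : ℕ) : ∃ (s : Y → projSpace X m) (K : Y × I → X),
    ContinuousOn s {y | 0 < ∑ i ∈ Finset.range (m + 1), N.bump i y} ∧
    ContinuousOn K ({y | 0 < ∑ i ∈ Finset.range (m + 1), N.bump i y} ×ˢ univ) ∧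
    (∀ y, 0 < ∑ i ∈ Finset.range (m + 1), N.bump i y → K (y, 0) = (projMap X m).toMap (s y)) ∧
    (∀ y, 0 < ∑ i ∈ Finset.range (m + 1), N.bump i y → K (y, 1) = g.toMap y) ∧
    s Y.base = (projSpace X m).base ∧ ∀ t, K (Y.base, t) = X.base := by
  have hsub : ∀ i y, 0 < N.bump i y → y ∈ N.V i := fun i y h =>
    N.tsupport_subset i (subset_tsupport _ h.ne')
  induction m with
  | zero =>
    simp only [zero_add, Finset.range_one, Finset.sum_singleton]
    refine ⟨fun _ => (projSpace X 0).base, N.H 0, continuousOn_const, (N.continuousOn 0).mono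
      fun p hp => ⟨hsub 0 p.1 hp.1, mem_univ _⟩, fun y hy => ?_, fun y hy =>
      N.H_one 0 y (hsub 0 y hy), rfl, N.H_base⟩
    rw [N.H_zero 0 y (hsub 0 y hy)]
    exact (projMap X 0).map_base.symm
  | succ m ih =>
    obtain ⟨s, K, hs, hK, hK0, hK1, hsb, hKb⟩ := ih
    let μ : C(Y, ℝ) := ⟨fun y => ∑ i ∈ Finset.range (m + 1), N.bump i y, by fun_prop⟩
    have hμ : ∀ y, 0 ≤ μ y := fun y =>
      Finset.sum_nonneg (s := Finset.range (m + 1)) (f := fun i => N.bump i y) fun i _ => N.nonneg i y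
    obtain ⟨s', K', h1, h2, h3, h4, h5⟩ := exists_lift_ganeaStep (ganea X m) g.toMap μ
      (N.bump (m + 1)) hμ (N.nonneg _) s K hs hK
      hK0 hK1 (N.H (m + 1)) ((N.continuousOn _).mono fun p hp => ⟨hsub _ p.1 hp.1, mem_univ _⟩)
      (fun y hy => N.H_zero _ y (hsub _ y hy)) (fun y hy => N.H_one _ y (hsub _ y hy))
    -- At the base point only bump `0` is non-zero, so the point lies where the step leaves the lift
    -- and homotopy unchanged; hence both remain pointed.
    have hbase : N.bump (m + 1) Y.base < μ Y.base := by
      rw [N.bump_base_of_ne (Nat.succ_ne_zero m)]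
      refine lt_of_lt_of_le zero_lt_one (N.bump_base_zero.symm.le.trans ?_)
      exact Finset.single_le_sum (s := Finset.range (m + 1)) (f := fun i => N.bump i Y.base)
        (fun i _ => N.nonneg i Y.base) (Finset.mem_range.2 (Nat.succ_pos m))
    have hsum : ∀ y, ∑ i ∈ Finset.range (m + 1 + 1), N.bump i y = μ y + N.bump (m + 1) y :=
      fun y => Finset.sum_range_succ (fun i => N.bump i y) (m + 1)
    simp only [hsum]
    refine ⟨s', K', h1, h2, h3, h4, ?_, fun t => ?_⟩
    · rw [(h5 _ hbase).1, hsb]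
      rfl
    · rw [(h5 _ hbase).2 t, hKb]

include N in
theorem exists_lift : ∃ s : PMap Y (projSpace X n), ((projMap X n).comp s).Homotopic g := by
  obtain ⟨s, K, hs, hK, hK0, hK1, hsb, hKb⟩ := N.exists_partial_lift n
  have hpos : ∀ y, 0 < ∑ i ∈ Finset.range (n + 1), N.bump i y := by
    intro y
    obtain ⟨i, hi⟩ := N.exists_eq_one y
    have hin : i ≤ n := by
      by_contra h
      have hy := N.tsupport_subset i (subset_tsupport _ (by simp [hi] : N.bump i y ≠ 0))
      rw [N.eq_empty i (by omega)] at hy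
      exact hy
    refine lt_of_lt_of_le zero_lt_one (hi.symm.le.trans ?_)
    exact Finset.single_le_sum (f := fun i => N.bump i y) (fun i _ => N.nonneg i y)
      (Finset.mem_range.2 (by omega))
  have huniv : {y | 0 < ∑ i ∈ Finset.range (n + 1), N.bump i y} = univ :=
    eq_univ_of_forall hpos
  rw [huniv] at hs hK
  rw [univ_prod_univ] at hK
  refine ⟨⟨⟨s, continuousOn_univ.1 hs⟩, hsb⟩, .of_continuous K (continuousOn_univ.1 hK)
    (fun y => hK0 y (hpos y)) (fun y => hK1 y (hpos y)) hKb⟩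

end NullCover

end LS

/-! ### Category covers, Ganea sections and the module weight -/

namespace LS

open Topology Metric Set

/-- `K` is covered by `n + 1` open subsets on each of which `f` is null-homotopic. -/
def HasCatCover {K X : PointedSpace.{u}} (f : PMap K X) (n : ℕ) : Prop :=
  ∃ U : Fin (n + 1) → Set K, (∀ i, IsOpen (U i)) ∧ (⋃ i, U i) = Set.univ ∧
    ∀ i, ContinuousMap.Homotopic (f.toMap.restrict (U i)) (ContinuousMap.const (U i) X.base)

theorem HasCatCover.catMap_le {K X : PointedSpace.{u}} {f : PMap K X} {n : ℕ}
    (h : HasCatCover f n) : catMap f ≤ n :=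
  iInf₂_le n h

theorem exists_hasCatCover_of_catMap_lt {K X : PointedSpace.{u}} {f : PMap K X} {m : ℕ}
    (h : catMap f < m) : ∃ n < m, HasCatCover f n := by
  simp only [catMap, iInf_lt_iff] at h
  obtain ⟨n, hn, hlt⟩ := h
  exact ⟨n, by exact_mod_cast hlt, hn⟩

theorem HasCatCover.comp_right {L K X : PointedSpace.{u}} {f : PMap K X} {n : ℕ}
    (h : HasCatCover f n) (φ : PMap L K) : HasCatCover (f.comp φ) n := by
  obtain ⟨U, hU, hcov, hnull⟩ := h
  refine ⟨fun i => φ.toMap ⁻¹' U i, fun i => (hU i).preimage φ.toMap.continuous, ?_, fun i => ?_⟩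
  · rw [← preimage_iUnion, hcov, preimage_univ]
  · rw [restrict_homotopic_const_iff]
    obtain ⟨h, hc, hh⟩ := (restrict_homotopic_const_iff _ _ _).1 (hnull i)
    refine ⟨fun p => h (φ.toMap p.1, p.2), hc.comp (Continuous.continuousOn (by fun_prop))
      fun p hp => ⟨hp.1, mem_univ _⟩, fun a ha => hh _ ha⟩

/-- The cover is pulled back to a CW model of `K`, where a numerable pointed version exists; the
null-homotopy then returns along the pointed equivalence. -/
theorem reducedDiagonal_comp_homotopic_const {K X : PointedSpace.{u}} (hK : HasCWType K)
    (f : PMap K X) {k : ℕ} (hk : catMap f < k) :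
    ((reducedDiagonal X k).comp f).Homotopic (PMap.const K (smashPower X k)) := by
  obtain ⟨n, hn, hcov⟩ := exists_hasCatCover_of_catMap_lt hk
  obtain ⟨Y, a, b, hY, hba, -⟩ := hK
  obtain ⟨U, h1, h2, h3⟩ := hcov.comp_right b
  obtain ⟨g', hg', ⟨N⟩⟩ := exists_nullCover hY (f.comp b) U h1 h2 h3
  have e1 := (hg'.comp_left (reducedDiagonal X k)).trans (N.reducedDiagonal_comp_homotopic_const hn)
  exact ((hba.comp_left ((reducedDiagonal X k).comp f)).symm).trans (e1.comp_right a)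

/-- Ganea's theorem: if `X` has category at most `n`, then `e_n : P ^ n ΩX → X` has a section up to
homotopy. -/
theorem HasCatCover.exists_section {X : PointedSpace.{u}} (hX : HasCWType X) {n : ℕ}
    (h : HasCatCover (PMap.id X) n) :
    ∃ s : PMap X (projSpace X n), ((projMap X n).comp s).Homotopic (PMap.id X) := by
  obtain ⟨Y, a, b, hY, hba, -⟩ := hX
  obtain ⟨U, h1, h2, h3⟩ := h.comp_right b
  obtain ⟨g', hg', ⟨N⟩⟩ := exists_nullCover hY _ U h1 h2 h3
  obtain ⟨s, hs⟩ := N.exists_lift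
  exact ⟨s.comp a, ((hs.trans hg'.symm).comp_right a).trans hba⟩

theorem Mwgt_le_cat (X : CWSpace.{u}) : Mwgt X ≤ cat X.toPointedSpace := by
  refine iSup_le fun h => le_iInf₂ fun n hn => iInf₂_le n ?_
  obtain ⟨s, hs⟩ := HasCatCover.exists_section X.hasCWType hn
  -- A class on `P^n` is a compatible family over all maps from CW-type spaces; its value at `s` is
  -- `s^*` of the class, so `s^*` is a left inverse of `(e_n)^*`.
  have key : ∀ (d : ℤ) (u : h.obj d X),
      (h.pullback d (projMap X.toPointedSpace n) u).1 X s = u := by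
    intro d u
    change h.map d ((projMap X.toPointedSpace n).comp s) u = u
    rw [h.map_homotopic d _ _ hs, h.map_id]
  refine ⟨fun d u v huv => ?_, ?_, fun d => ?_, fun d => ?_, ?_⟩
  · rw [← key d u, huv, key d v]
  · rintro θ - d m hdm _ ⟨u, rfl⟩
    refine ⟨θ.app d m hdm X u, ?_⟩
    ext K g
    exact θ.natural d m hdm _ u
  -- The kernel of `s^*` is the complement.
  · exact AddMonoidHom.ker (⟨⟨fun w => w.1 X s, rfl⟩, fun _ _ => rfl⟩ :
      h.onSpace d (projSpace X.toPointedSpace n) →+ h.obj d X)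
  · refine ⟨disjoint_iff.2 ((AddSubgroup.eq_bot_iff_forall _).2 ?_),
      codisjoint_iff.2 ((AddSubgroup.eq_top_iff' _).2 fun w => ?_)⟩
    · rintro _ ⟨⟨u, rfl⟩, hu⟩
      have hu' : (h.pullback d (projMap X.toPointedSpace n) u).1 X s = 0 := hu
      rw [key] at hu'
      rw [hu', map_zero]
    · refine AddSubgroup.mem_sup.2 ⟨_, ⟨w.1 X s, rfl⟩,
        w - h.pullback d (projMap X.toPointedSpace n) (w.1 X s), ?_, add_sub_cancel _ _⟩
      change w.1 X s - (h.pullback d (projMap X.toPointedSpace n) (w.1 X s)).1 X s = 0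
      rw [key, sub_self]
  · rintro θ - d m hdm w hw
    have hw' : w.1 X s = 0 := hw
    change θ.app d m hdm X (w.1 X s) = 0
    rw [hw', map_zero]

/-! ### The category of the Ganea maps and the category weight -/

theorem continuousOn_sum_prod {A B C Z : Type*} [TopologicalSpace A] [TopologicalSpace B]
    [TopologicalSpace C] [TopologicalSpace Z] {S : Set (A ⊕ B)} (hS : IsOpen S)
    {k : (A ⊕ B) × C → Z}
    (h1 : ContinuousOn (fun p : A × C => k (Sum.inl p.1, p.2)) ((Sum.inl ⁻¹' S) ×ˢ univ))
    (h2 : ContinuousOn (fun p : B × C => k (Sum.inr p.1, p.2)) ((Sum.inr ⁻¹' S) ×ˢ univ)) :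
    ContinuousOn k (S ×ˢ univ) := by
  rintro ⟨a | b, c⟩ ⟨hp, -⟩
  · refine ContinuousAt.continuousWithinAt ?_
    have he : IsOpenEmbedding (Prod.map Sum.inl id : A × C → (A ⊕ B) × C) :=
      IsOpenEmbedding.inl.prodMap .id
    exact (he.continuousAt_iff (x := (a, c))).1 (h1.continuousAt
      (((hS.preimage continuous_inl).prod isOpen_univ).mem_nhds ⟨hp, mem_univ _⟩))
  · refine ContinuousAt.continuousWithinAt ?_
    have he : IsOpenEmbedding (Prod.map Sum.inr id : B × C → (A ⊕ B) × C) :=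
      IsOpenEmbedding.inr.prodMap .id
    exact (he.continuousAt_iff (x := (b, c))).1 (h2.continuousAt
      (((hS.preimage continuous_inr).prod isOpen_univ).mem_nhds ⟨hp, mem_univ _⟩))

/-- A quotient map stays one over an open set and after taking the product with a locally compact
space; this gives continuity of homotopies on mapping cones. -/
theorem continuousOn_of_isQuotientMap {A Q C Z : Type*} [TopologicalSpace A] [TopologicalSpace Q]
    [TopologicalSpace C] [LocallyCompactSpace C] [TopologicalSpace Z] {π : A → Q}
    (hπ : IsQuotientMap π) {W : Set Q} (hW : IsOpen W) {g : Q × C → Z}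
    (h : ContinuousOn (fun p : A × C => g (π p.1, p.2)) ((π ⁻¹' W) ×ˢ univ)) :
    ContinuousOn g (W ×ˢ univ) := by
  have hq := hπ.restrictPreimage_isOpen hW
  have hc : Continuous fun p : W × C => g (p.1, p.2) := by
    refine hq.continuous_lift_prod_left (g := fun p : W × C => g (p.1, p.2)) ?_
    exact h.comp_continuous (f := fun p : (π ⁻¹' W) × C => ((p.1 : A), p.2)) (by fun_prop)
      fun p => ⟨p.1.2, mem_univ _⟩
  rintro ⟨q, c⟩ ⟨hp, -⟩
  refine ContinuousAt.continuousWithinAt ?_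
  have he : IsOpenEmbedding (Prod.map Subtype.val id : W × C → Q × C) :=
    hW.isOpenEmbedding_subtypeVal.prodMap .id
  exact (he.continuousAt_iff (x := (⟨q, hp⟩, c))).1 hc.continuousAt

theorem MappingCone.isQuotientMap_mk {E Y : Type u} [TopologicalSpace E] [TopologicalSpace Y]
    (p : E → Y) : IsQuotientMap (Quot.mk (ConeRel p) : Y ⊕ (E × I) → MappingCone p) :=
  isQuotientMap_quot_mk

/-- The open cover of the next stage of the fibre-cofibre construction: the open cone, and, for each
member of a cover of the given stage, its preimage under the projection of the complement of the
vertex. -/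
theorem HasCatCover.ganeaStep {X : PointedSpace.{u}} {S : SpaceOver X} {m : ℕ}
    (h : HasCatCover S.map m) : HasCatCover (ganeaStep S).map (m + 1) := by
  classical
  obtain ⟨U, hU, hcov, hnull⟩ := h
  choose h hc hh using fun i => (restrict_homotopic_const_iff _ _ _).1 (hnull i)
  let M := MappingCone (MappingFibre.proj S.map)
  let mk : S.space ⊕ (MappingFibre S.map × I) → M := Quot.mk _
  have hmk : IsQuotientMap mk := MappingCone.isQuotientMap_mk _
  let C : Set M := {q | Quot.lift (Sum.elim (fun _ => False) fun w => w.2 < 1) (by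
    rintro _ _ (z | ⟨z, z'⟩)
    · simp
    · rfl) q}
  let W : Fin (m + 1) → Set M := fun i => {q | Quot.lift (Sum.elim (fun y => y ∈ U i)
    fun w => 0 < w.2 ∧ w.1.1.1 ∈ U i) (by
      rintro _ _ (z | ⟨z, z'⟩)
      · simp [MappingFibre.proj]
      · simp) q}
  have hC : IsOpen C := by
    rw [← hmk.isOpen_preimage]
    refine isOpen_sum_iff.2 ⟨?_, ?_⟩
    · exact isOpen_empty
    · exact isOpen_lt continuous_snd continuous_const
  have hproj : Continuous fun w : MappingFibre S.map × I => w.1.1.1 :=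
    continuous_fst.comp (continuous_subtype_val.comp continuous_fst)
  have hpath : Continuous fun w : MappingFibre S.map × I => w.1.1.2 :=
    continuous_snd.comp (continuous_subtype_val.comp continuous_fst)
  have hW : ∀ i, IsOpen (W i) := by
    intro i
    rw [← hmk.isOpen_preimage]
    refine isOpen_sum_iff.2 ⟨hU i, ?_⟩
    exact (isOpen_lt continuous_const continuous_snd).inter ((hU i).preimage hproj)
  refine ⟨Fin.cons C W, Fin.cases hC hW, ?_, Fin.cases ?_ fun i => ?_⟩
  · refine eq_univ_of_forall fun q => mem_iUnion.2 ?_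
    have hex : ∀ y, ∃ i, y ∈ U i := fun y => mem_iUnion.1 (hcov ▸ mem_univ y : y ∈ ⋃ i, U i)
    obtain ⟨y | ⟨z, t⟩, rfl⟩ := Quot.exists_rep q
    · obtain ⟨i, hi⟩ := hex y
      exact ⟨i.succ, hi⟩
    · by_cases ht : t < 1
      · exact ⟨0, ht⟩
      · obtain ⟨i, hi⟩ := hex z.1.1
        exact ⟨i.succ, zero_lt_one.trans_le (not_lt.1 ht), hi⟩
  · rw [restrict_homotopic_const_iff]
    -- On the open cone the path `γ` itself is the contraction: `γ (s t)` runs from the base point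
    -- to `γ t`. The values on `Y` and at cone coordinate `1` lie outside `C` and only make the lift
    -- well defined.
    let H : M × I → X := fun p => Quot.lift (Sum.elim (fun _ _ => X.base)
      fun w s => if w.2 = 1 then X.base else w.1.1.2 (s * w.2)) (by
        rintro _ _ (z | ⟨z, z'⟩)
        · ext s; simp
        · ext s; simp [z.2.1, z'.2.1]) p.1 p.2
    refine ⟨H, ?_, ?_⟩
    · refine continuousOn_of_isQuotientMap hmk hC (continuousOn_sum_prod (hC.preimage hmk.continuous)
        continuousOn_const ?_)
      refine ContinuousOn.congr (f := fun p : (MappingFibre S.map × I) × I =>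
        p.1.1.1.2 (p.2 * p.1.2)) (Continuous.continuousOn ?_) ?_
      · exact (hpath.comp continuous_fst).eval (by fun_prop)
      · exact fun p hp => if_neg (ne_of_lt hp.1)
    · intro q hq
      obtain ⟨y | ⟨z, t⟩, rfl⟩ := Quot.exists_rep q
      · exact hq.elim
      · have ht : t ≠ 1 := ne_of_lt hq
        constructor
        · refine (if_neg ht).trans ?_
          simp [z.2.1]
        · refine (if_neg ht).trans ?_
          simp only [one_mul]
          rfl
  · rw [restrict_homotopic_const_iff]
    -- The first half contracts the image of the end of the cone line, using the given cover; the
    -- second half follows `γ` backwards from `γ 1` to `γ t`. The vertex lies outside `W i` and gets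
    -- a default value.
    let H : M × I → X := fun p => Quot.lift (Sum.elim
      (fun y s => if (s : ℝ) ≤ 1 / 2 then h i (y, toI (2 * s)) else S.map.toMap y)
      fun w s => if w.2 = 0 then X.base else if (s : ℝ) ≤ 1 / 2 then h i (w.1.1.1, toI (2 * s))
        else w.1.1.2 (toI (1 - (2 * s - 1) * (1 - w.2)))) (by
        rintro _ _ (z | ⟨z, z'⟩)
        · ext s; simp [MappingFibre.proj, z.2.2]
        · ext s; simp) p.1 p.2
    refine ⟨H, ?_, ?_⟩
    · refine continuousOn_of_isQuotientMap hmk (hW i) (continuousOn_sum_prod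
        ((hW i).preimage hmk.continuous) ?_ ?_)
      · refine ContinuousOn.if ?_ ?_ ?_
        · rintro ⟨y, s⟩ ⟨⟨hy, -⟩, hs⟩
          have : (s : ℝ) = 1 / 2 := frontier_le_subset_eq (f := fun p : S.space × I => (p.2 : ℝ))
            (g := fun _ => 1 / 2) (by fun_prop) (by fun_prop) hs
          simp only [this]
          norm_num
          exact (hh i y hy).2
        · refine (hc i).comp (Continuous.continuousOn (by fun_prop)) ?_
          exact fun p hp => ⟨hp.1.1, mem_univ _⟩
        · exact Continuous.continuousOn (by fun_prop)
      · refine ContinuousOn.congr (f := fun p : (MappingFibre S.map × I) × I =>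
          if (p.2 : ℝ) ≤ 1 / 2 then h i (p.1.1.1.1, toI (2 * p.2))
          else p.1.1.1.2 (toI (1 - (2 * p.2 - 1) * (1 - p.1.2)))) ?_ ?_
        · refine ContinuousOn.if ?_ ?_ ?_
          · rintro ⟨⟨z, t⟩, s⟩ ⟨⟨hy, -⟩, hs⟩
            have : (s : ℝ) = 1 / 2 :=
              frontier_le_subset_eq (f := fun p : (MappingFibre S.map × I) × I => (p.2 : ℝ))
              (g := fun _ => 1 / 2) (by fun_prop) (by fun_prop) hs
            simp only [this]
            norm_num
            rw [(hh i _ hy.2).2, z.2.2]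
          · refine (hc i).comp (Continuous.continuousOn
              ((hproj.comp continuous_fst).prodMk (by fun_prop))) ?_
            exact fun p hp => ⟨hp.1.1.2, mem_univ _⟩
          · exact Continuous.continuousOn ((hpath.comp continuous_fst).eval (by fun_prop))
        · exact fun p hp => if_neg (ne_of_gt hp.1.1)
    · intro q hq
      obtain ⟨y | ⟨z, t⟩, rfl⟩ := Quot.exists_rep q
      · have hy : y ∈ U i := hq
        constructor
        · change (if ((0 : I) : ℝ) ≤ 1 / 2 then h i (y, toI (2 * (0 : I))) else S.map.toMap y) = _
          simp [(hh i y hy).1]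
        · change (if ((1 : I) : ℝ) ≤ 1 / 2 then h i (y, toI (2 * (1 : I))) else S.map.toMap y) = _
          rw [if_neg (by norm_num)]
          rfl
      · have hz : z.1.1 ∈ U i := hq.2
        have ht : t ≠ 0 := ne_of_gt hq.1
        constructor
        · refine (if_neg ht).trans ?_
          simp [(hh i _ hz).1]
        · refine (if_neg ht).trans ((if_neg (by norm_num)).trans ?_)
          norm_num
          rfl

theorem hasCatCover_projMap (X : PointedSpace.{u}) (m : ℕ) : HasCatCover (projMap X m) m := by
  induction m with
  | zero =>
    refine ⟨fun _ => univ, fun _ => isOpen_univ, iUnion_const univ, fun i => ?_⟩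
    exact ContinuousMap.Homotopic.refl _
  | succ m ih => exact ih.ganeaStep

/-- Every map that factors through `e_m` has category at most `m`, so a class of weight exceeding
`m` pulls back to zero on all of `P^m`, contradicting injectivity. The direct summand condition
plays no role here. -/
theorem wgt_le_Mwgt (X : CWSpace.{u}) : wgt X ≤ Mwgt X := by
  refine iSup_mono fun h => iSup_le fun d => iSup₂_le fun u hu => le_iInf₂ fun m hm =>
    iSup₂_le fun k hk => ?_
  by_contra hlt
  refine hu (hm.1 d ?_)
  rw [map_zero]
  ext K g
  refine hk K _ (lt_of_le_of_lt ?_ (not_le.1 hlt))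
  exact ((hasCatCover_projMap _ m).comp_right g).catMap_le

end LS

/-! ### Cohomology represented by loop spaces -/

namespace LS

open Topology Metric Set

theorem PMap.ext_fun {X Y : PointedSpace.{u}} {f g : PMap X Y}
    (h : ∀ x, f.toMap x = g.toMap x) : f = g :=
  PMap.ext (ContinuousMap.ext h)

/-! ### Loop spaces -/

/-- The loop space of a pointed space. -/
def loops (W : PointedSpace.{u}) : PointedSpace.{u} where
  carrier := {γ : C(I, W) // γ 0 = W.base ∧ γ 1 = W.base}
  base := ⟨ContinuousMap.const I W.base, rfl, rfl⟩

namespace loops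

variable {A W V : PointedSpace.{u}}

/-- The value of a loop. -/
def eval (γ : loops W) (t : I) : W := γ.1 t

@[simp] theorem eval_zero (γ : loops W) : eval γ 0 = W.base := γ.2.1

@[simp] theorem eval_one (γ : loops W) : eval γ 1 = W.base := γ.2.2

@[simp] theorem eval_base (t : I) : eval (loops W).base t = W.base := rfl

@[ext] theorem ext {γ δ : loops W} (h : ∀ t, eval γ t = eval δ t) : γ = δ :=
  Subtype.ext (ContinuousMap.ext h)

theorem continuous_eval {T : Type*} [TopologicalSpace T] {f : T → loops W} {t : T → I}
    (hf : Continuous f) (ht : Continuous t) : Continuous fun x => eval (f x) (t x) :=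
  (continuous_subtype_val.comp hf).eval ht

/-- A family of loops given by a function of two variables. -/
def ofFun {T : Type*} [TopologicalSpace T] (F : T × I → W) (hF : Continuous F)
    (h0 : ∀ x, F (x, 0) = W.base) (h1 : ∀ x, F (x, 1) = W.base) (x : T) : loops W :=
  ⟨⟨fun t => F (x, t), by fun_prop⟩, h0 x, h1 x⟩

theorem continuous_ofFun {T : Type*} [TopologicalSpace T] (F : T × I → W) (hF : Continuous F)
    (h0 : ∀ x, F (x, 0) = W.base) (h1 : ∀ x, F (x, 1) = W.base) : Continuous (ofFun F hF h0 h1) :=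
  Continuous.subtype_mk (ContinuousMap.curry ⟨F, hF⟩).continuous _

theorem continuous_iff {T : Type*} [TopologicalSpace T] {f : T → loops W} :
    Continuous f ↔ Continuous fun p : T × I => eval (f p.1) p.2 := by
  refine ⟨fun h => continuous_eval (h.comp continuous_fst) continuous_snd, fun h => ?_⟩
  exact continuous_ofFun (fun p : T × I => eval (f p.1) p.2) h (fun x => eval_zero _)
    fun x => eval_one _

/-- Concatenation of loops. -/
def trans (γ δ : loops W) : loops W :=
  ⟨⟨fun t => if (t : ℝ) ≤ 1 / 2 then eval γ (toI (2 * t)) else eval δ (toI (2 * t - 1)), by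
    refine Continuous.if_le (continuous_eval continuous_const (by fun_prop))
      (continuous_eval continuous_const (by fun_prop)) (by fun_prop) (by fun_prop) ?_
    intro t ht
    rw [ht]
    norm_num⟩, by simp, by
    change (if ((1 : I) : ℝ) ≤ 1 / 2 then _ else _) = _
    rw [if_neg (by norm_num)]
    norm_num⟩

theorem eval_trans (γ δ : loops W) (t : I) : eval (trans γ δ) t =
    if (t : ℝ) ≤ 1 / 2 then eval γ (toI (2 * t)) else eval δ (toI (2 * t - 1)) := rfl

theorem continuous_trans {T : Type*} [TopologicalSpace T] {f g : T → loops W} (hf : Continuous f)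
    (hg : Continuous g) : Continuous fun x => trans (f x) (g x) := by
  rw [continuous_iff]
  refine Continuous.if_le (continuous_eval (hf.comp continuous_fst) (by fun_prop))
    (continuous_eval (hg.comp continuous_fst) (by fun_prop)) (by fun_prop) (by fun_prop) ?_
  rintro ⟨x, t⟩ ht
  simp only at ht
  simp only [ht]
  norm_num

@[simp] theorem trans_base : trans (loops W).base (loops W).base = (loops W).base := by
  ext t
  rw [eval_trans]
  split_ifs <;> rfl

/-- Looping a pointed map. -/
def map (f : PMap W V) : PMap (loops W) (loops V) where
  toMap :=
    { toFun := fun γ => ⟨⟨fun t => f.toMap (eval γ t), f.toMap.continuous.comp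
          (continuous_eval continuous_const continuous_id)⟩,
        by simp [f.map_base], by simp [f.map_base]⟩
      continuous_toFun := continuous_iff.2
        (f.toMap.continuous.comp (continuous_eval continuous_fst continuous_snd)) }
  map_base := by ext t; exact f.map_base

@[simp] theorem eval_map (f : PMap W V) (γ : loops W) (t : I) :
    eval ((map f).toMap γ) t = f.toMap (eval γ t) := rfl

theorem map_homotopic {f g : PMap W V} (h : f.Homotopic g) : (map f).Homotopic (map g) := by
  obtain ⟨K, hK, h0, h1, hb⟩ := h.exists_continuous
  have hc : Continuous fun p : (loops W × I) × I => K (eval p.1.1 p.2, p.1.2) :=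
    hK.comp ((continuous_eval (continuous_fst.comp continuous_fst) continuous_snd).prodMk
      (continuous_snd.comp continuous_fst))
  refine .of_continuous (ofFun (fun p : (loops W × I) × I => K (eval p.1.1 p.2, p.1.2)) hc
    (fun p => by simp [hb]) (fun p => by simp [hb])) (continuous_ofFun _ _ _ _) (fun γ => ?_)
    (fun γ => ?_) fun s => ?_
  · ext t; exact h0 _
  · ext t; exact h1 _
  · ext t; exact hb _

theorem trans_map (f : PMap W V) (γ δ : loops W) :
    trans ((map f).toMap γ) ((map f).toMap δ) = (map f).toMap (trans γ δ) := by
  ext t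
  simp only [eval_trans, eval_map]
  split_ifs <;> rfl

/-- The self-map of the loop space given by a reparametrisation that maps the end points of the unit
interval to end points. -/
def reparam (W : PointedSpace.{u}) (p : C(I, I)) (h0 : p 0 = 0 ∨ p 0 = 1) (h1 : p 1 = 0 ∨ p 1 = 1) :
    PMap (loops W) (loops W) where
  toMap :=
    { toFun := fun γ => ⟨⟨fun t => eval γ (p t), continuous_eval continuous_const p.continuous⟩,
        by rcases h0 with h | h <;> simp [h], by rcases h1 with h | h <;> simp [h]⟩
      continuous_toFun := continuous_iff.2 (continuous_eval
        (f := fun a : loops W × I => a.1) (t := fun a => p a.2) continuous_fst (by fun_prop)) }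
  map_base := rfl

/-- The straight-line homotopy in the interval fixes the common end values. It yields the unit and
inverse laws below. -/
theorem reparam_homotopic {p q : C(I, I)} (h0 : p 0 = 0 ∨ p 0 = 1) (h1 : p 1 = 0 ∨ p 1 = 1)
    (h0' : q 0 = 0 ∨ q 0 = 1) (h1' : q 1 = 0 ∨ q 1 = 1) (e0 : p 0 = q 0) (e1 : p 1 = q 1) :
    (reparam W p h0 h1).Homotopic (reparam W q h0' h1') := by
  have hc : Continuous fun a : (loops W × I) × I =>
      eval a.1.1 (toI ((1 - a.1.2) * p a.2 + a.1.2 * q a.2)) :=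
    continuous_eval (continuous_fst.comp continuous_fst) (by fun_prop)
  refine .of_continuous (ofFun _ hc (fun a => ?_) (fun a => ?_)) (continuous_ofFun _ _ _ _)
    (fun γ => ?_) (fun γ => ?_) fun s => ?_
  · have : (1 - (a.2 : ℝ)) * (q 0 : ℝ) + a.2 * q 0 = q 0 := by ring
    simp only [e0, this, toI_coe]
    rcases h0' with h | h <;> simp [h]
  · have : (1 - (a.2 : ℝ)) * (q 1 : ℝ) + a.2 * q 1 = q 1 := by ring
    simp only [e1, this, toI_coe]
    rcases h1' with h | h <;> simp [h]
  · ext t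
    change eval γ (toI ((1 - ((0 : I) : ℝ)) * p t + ((0 : I) : ℝ) * q t)) = eval γ (p t)
    simp
  · ext t
    change eval γ (toI ((1 - ((1 : I) : ℝ)) * p t + ((1 : I) : ℝ) * q t)) = eval γ (q t)
    simp
  · ext t
    rfl

/-- Concatenation with the constant loop on the right. -/
def transBase (W : PointedSpace.{u}) : PMap (loops W) (loops W) where
  toMap := ⟨fun γ => trans γ (loops W).base, continuous_trans continuous_id continuous_const⟩
  map_base := trans_base

/-- Concatenation with the constant loop on the left. -/
def baseTrans (W : PointedSpace.{u}) : PMap (loops W) (loops W) where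
  toMap := ⟨fun γ => trans (loops W).base γ, continuous_trans continuous_const continuous_id⟩
  map_base := trans_base

/-- Reversal of loops. -/
def inv (W : PointedSpace.{u}) : PMap (loops W) (loops W) :=
  reparam W ⟨σ, by fun_prop⟩ (by simp) (by simp)

/-- The concatenation of the reversed loop with the loop. -/
def invTrans (W : PointedSpace.{u}) : PMap (loops W) (loops W) where
  toMap := ⟨fun γ => trans ((inv W).toMap γ) γ,
    continuous_trans (inv W).toMap.continuous continuous_id⟩
  map_base := by
    change trans ((inv W).toMap (loops W).base) (loops W).base = _
    rw [(inv W).map_base, trans_base]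

theorem transBase_homotopic : (transBase W).Homotopic (PMap.id (loops W)) := by
  have e : transBase W = reparam W ⟨fun t => toI (2 * t), by fun_prop⟩ (by simp)
      (by right; exact toI_of_one_le (by norm_num)) := by
    refine PMap.ext_fun fun γ => ext fun t => ?_
    change eval (trans γ (loops W).base) t = eval γ (toI (2 * t))
    rw [eval_trans]
    split_ifs with h
    · rfl
    · rw [toI_of_one_le (r := 2 * (t : ℝ)) (by linarith)]; simp
  rw [e]
  refine reparam_homotopic (q := ContinuousMap.id I) _ _ (by simp) (by simp) ?_ ?_
  · simp
  · exact toI_of_one_le (by norm_num)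

theorem baseTrans_homotopic : (baseTrans W).Homotopic (PMap.id (loops W)) := by
  have e : baseTrans W = reparam W ⟨fun t => toI (2 * t - 1), by fun_prop⟩
      (by left; exact toI_of_nonpos (by norm_num))
      (by right; exact toI_of_one_le (by norm_num)) := by
    refine PMap.ext_fun fun γ => ext fun t => ?_
    change eval (trans (loops W).base γ) t = eval γ (toI (2 * t - 1))
    rw [eval_trans]
    split_ifs with h
    · rw [toI_of_nonpos (r := 2 * (t : ℝ) - 1) (by linarith)]; simp
    · rfl
  rw [e]
  refine reparam_homotopic (q := ContinuousMap.id I) _ _ (by simp) (by simp) ?_ ?_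
  · exact toI_of_nonpos (by norm_num)
  · exact toI_of_one_le (by norm_num)

theorem invTrans_homotopic : (invTrans W).Homotopic (PMap.const (loops W) (loops W)) := by
  -- The reversed loop followed by the loop is the reparametrisation `|1 - 2t|`, with both end
  -- values `1`; it deforms to the constant `1`, which gives the constant loop.
  have e : invTrans W = reparam W ⟨fun t => toI |1 - 2 * t|, by fun_prop⟩
      (by right; exact toI_of_one_le (by norm_num))
      (by right; exact toI_of_one_le (by norm_num)) := by
    refine PMap.ext_fun fun γ => ext fun t => ?_
    change eval (trans ((inv W).toMap γ) γ) t = eval γ (toI |1 - 2 * t|)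
    rw [eval_trans]
    split_ifs with h
    · change eval γ (σ (toI (2 * t))) = _
      congr 1
      apply Subtype.ext
      have h1 : 0 ≤ 1 - 2 * (t : ℝ) := by linarith
      rw [abs_of_nonneg h1, unitInterval.coe_symm_eq, coe_toI (by linarith [t.2.1]) (by linarith),
        coe_toI h1 (by linarith [t.2.1])]
    · rw [abs_of_nonpos (by linarith), neg_sub]
  have e' : PMap.const (loops W) (loops W) =
      reparam W (ContinuousMap.const I 1) (by simp) (by simp) := by
    refine PMap.ext_fun fun γ => ext fun t => ?_
    exact (eval_one γ).symm
  rw [e, e']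
  refine reparam_homotopic _ _ _ _ ?_ ?_
  · exact toI_of_one_le (by norm_num)
  · exact toI_of_one_le (by norm_num)

end loops

/-! ### Homotopy classes of maps into double loop spaces -/

/-- The setoid of pointed homotopy. -/
def homotopySetoid (A W : PointedSpace.{u}) : Setoid (PMap A W) where
  r := PMap.Homotopic
  iseqv := ⟨.refl, .symm, .trans⟩

/-- The set of pointed homotopy classes of pointed maps. -/
def Bracket (A W : PointedSpace.{u}) : Type u := Quotient (homotopySetoid A W)

namespace Bracket

variable {A B W V : PointedSpace.{u}}

/-- The homotopy class of a pointed map. -/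
def mk (f : PMap A W) : Bracket A W := Quotient.mk _ f

theorem mk_eq_mk {f g : PMap A W} : mk f = mk g ↔ f.Homotopic g := Quotient.eq

theorem ind {p : Bracket A W → Prop} (h : ∀ f, p (mk f)) (x : Bracket A W) : p x :=
  Quotient.inductionOn x h

/-- The map induced by a pointed map of the sources. -/
def precomp (W : PointedSpace.{u}) (φ : PMap A B) : Bracket B W → Bracket A W :=
  Quotient.map (fun f => f.comp φ) fun _ _ h => PMap.Homotopic.comp_right h φ

/-- The map induced by a pointed map of the targets. -/
def postcomp (A : PointedSpace.{u}) (ψ : PMap W V) : Bracket A W → Bracket A V :=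
  Quotient.map (fun f => ψ.comp f) fun _ _ h => PMap.Homotopic.comp_left h ψ

/-- Pointwise concatenation of maps into a loop space. -/
def concat (f g : PMap A (loops W)) : PMap A (loops W) where
  toMap := ⟨fun a => loops.trans (f.toMap a) (g.toMap a),
    loops.continuous_trans f.toMap.continuous g.toMap.continuous⟩
  map_base := by
    change loops.trans (f.toMap A.base) (g.toMap A.base) = _
    rw [f.map_base, g.map_base, loops.trans_base]

/-- Pointwise concatenation, in the inner loop coordinate, of maps into a double loop space. -/
def innerConcat (f g : PMap A (loops (loops W))) : PMap A (loops (loops W)) where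
  toMap := ⟨loops.ofFun (fun p : A × I =>
      loops.trans (loops.eval (f.toMap p.1) p.2) (loops.eval (g.toMap p.1) p.2))
    (loops.continuous_trans
      (loops.continuous_eval (f.toMap.continuous.comp continuous_fst) continuous_snd)
      (loops.continuous_eval (g.toMap.continuous.comp continuous_fst) continuous_snd))
    (fun a => by simp) (fun a => by simp), loops.continuous_ofFun _ _ _ _⟩
  map_base := by
    refine loops.ext fun t => ?_
    change loops.trans (loops.eval (f.toMap A.base) t) (loops.eval (g.toMap A.base) t) = _
    rw [f.map_base, g.map_base]
    simp

theorem concat_homotopic {f f' g g' : PMap A (loops W)} (hf : f.Homotopic f')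
    (hg : g.Homotopic g') : (concat f g).Homotopic (concat f' g') := by
  obtain ⟨K, hK, h0, h1, hb⟩ := hf.exists_continuous
  obtain ⟨L, hL, k0, k1, kb⟩ := hg.exists_continuous
  refine .of_continuous (fun p => loops.trans (K p) (L p)) (loops.continuous_trans hK hL)
    (fun x => ?_) (fun x => ?_) fun t => ?_
  · rw [h0, k0]; rfl
  · rw [h1, k1]; rfl
  · rw [hb, kb, loops.trans_base]

theorem innerConcat_homotopic {f f' g g' : PMap A (loops (loops W))} (hf : f.Homotopic f')
    (hg : g.Homotopic g') : (innerConcat f g).Homotopic (innerConcat f' g') := by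
  obtain ⟨K, hK, h0, h1, hb⟩ := hf.exists_continuous
  obtain ⟨L, hL, k0, k1, kb⟩ := hg.exists_continuous
  refine .of_continuous (loops.ofFun (fun p : (A × I) × I =>
      loops.trans (loops.eval (K p.1) p.2) (loops.eval (L p.1) p.2))
    (loops.continuous_trans
      (loops.continuous_eval (hK.comp continuous_fst) continuous_snd)
      (loops.continuous_eval (hL.comp continuous_fst) continuous_snd))
    (fun a => by simp) (fun a => by simp)) (loops.continuous_ofFun _ _ _ _)
    (fun x => ?_) (fun x => ?_) fun t => ?_
  · refine loops.ext fun t => ?_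
    change loops.trans (loops.eval (K (x, 0)) t) (loops.eval (L (x, 0)) t) = _
    rw [h0, k0]; rfl
  · refine loops.ext fun t => ?_
    change loops.trans (loops.eval (K (x, 1)) t) (loops.eval (L (x, 1)) t) = _
    rw [h1, k1]; rfl
  · refine loops.ext fun s => ?_
    change loops.trans (loops.eval (K (A.base, t)) s) (loops.eval (L (A.base, t)) s) = _
    rw [hb, kb]; simp

/-- The sum of classes of maps into a loop space. -/
def add : Bracket A (loops W) → Bracket A (loops W) → Bracket A (loops W) :=
  Quotient.map₂ concat fun _ _ h _ _ h' => concat_homotopic h h'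

/-- The sum of classes of maps into a double loop space, in the inner loop coordinate. -/
def innerAdd : Bracket A (loops (loops W)) → Bracket A (loops (loops W)) →
    Bracket A (loops (loops W)) :=
  Quotient.map₂ innerConcat fun _ _ h _ _ h' => innerConcat_homotopic h h'

theorem add_isUnital : EckmannHilton.IsUnital (add (A := A) (W := W)) (mk (PMap.const A _)) where
  left_id := ind fun f => mk_eq_mk.2 (loops.baseTrans_homotopic.comp_right f)
  right_id := ind fun f => mk_eq_mk.2 (loops.transBase_homotopic.comp_right f)

theorem innerAdd_isUnital :
    EckmannHilton.IsUnital (innerAdd (A := A) (W := W)) (mk (PMap.const A _)) where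
  left_id := ind fun f =>
    mk_eq_mk.2 ((loops.map_homotopic loops.baseTrans_homotopic).comp_right f)
  right_id := ind fun f =>
    mk_eq_mk.2 ((loops.map_homotopic loops.transBase_homotopic).comp_right f)

/-- Concatenations in different loop coordinates commute on the nose. With the unit laws this is the
input of the Eckmann-Hilton argument. -/
theorem innerAdd_interchange (a b c d : Bracket A (loops (loops W))) :
    innerAdd (add a b) (add c d) = add (innerAdd a c) (innerAdd b d) := by
  revert a b c d
  refine ind fun a => ind fun b => ind fun c => ind fun d => congrArg mk ?_
  refine PMap.ext_fun fun x => loops.ext fun t => ?_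
  change loops.trans (loops.eval (loops.trans (a.toMap x) (b.toMap x)) t)
    (loops.eval (loops.trans (c.toMap x) (d.toMap x)) t) =
    loops.eval (loops.trans ((innerConcat a c).toMap x) ((innerConcat b d).toMap x)) t
  simp only [loops.eval_trans (W := loops W)]
  split_ifs <;> rfl

instance : Zero (Bracket A (loops (loops W))) := ⟨mk (PMap.const A _)⟩

instance : Add (Bracket A (loops (loops W))) := ⟨add⟩

instance : Neg (Bracket A (loops (loops W))) := ⟨postcomp A (loops.inv (loops W))⟩

instance : AddCommGroup (Bracket A (loops (loops W))) where
  add_assoc := (EckmannHilton.mul_assoc innerAdd_isUnital add_isUnital innerAdd_interchange).assoc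
  add_comm := (EckmannHilton.mul_comm innerAdd_isUnital add_isUnital innerAdd_interchange).comm
  zero_add := add_isUnital.left_id
  add_zero := add_isUnital.right_id
  neg_add_cancel := ind fun f => mk_eq_mk.2 (loops.invTrans_homotopic.comp_right f)
  nsmul := nsmulRec
  zsmul := zsmulRec

/-- Needed for the suspension isomorphism: currying makes the suspension coordinate the new outer
loop, so the old outer sum becomes an inner one. -/
theorem innerAdd_eq_add (x y : Bracket A (loops (loops W))) : innerAdd x y = x + y :=
  congrFun₂ (EckmannHilton.mul innerAdd_isUnital add_isUnital innerAdd_interchange) x y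

/-- The homomorphism induced by a pointed map of the sources. -/
def precompHom (W : PointedSpace.{u}) (φ : PMap A B) :
    Bracket B (loops (loops W)) →+ Bracket A (loops (loops W)) :=
  AddMonoidHom.mk' (precomp _ φ) (ind fun _ => ind fun _ => rfl)

/-- The homomorphism induced by a pointed map of the targets. -/
def postcompHom (A : PointedSpace.{u}) (ψ : PMap W V) :
    Bracket A (loops (loops W)) →+ Bracket A (loops (loops V)) :=
  AddMonoidHom.mk' (postcomp A (loops.map (loops.map ψ))) (ind fun f => ind fun g => by
    refine congrArg mk (PMap.ext_fun fun x => ?_)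
    exact (loops.trans_map (loops.map ψ) (f.toMap x) (g.toMap x)).symm)

end Bracket

/-! ### The adjunction between suspension and loops -/

/-- The adjoint of a map out of a suspension. -/
def curryPMap {A W : PointedSpace.{u}} (g : PMap (susp A) W) : PMap A (loops W) where
  toMap := ⟨loops.ofFun (fun p : A × I => g.toMap (Quotient.mk (collapseSetoid (suspSet A)) p))
      (g.toMap.continuous.comp continuous_quotient_mk')
      (fun a => (congrArg g.toMap (Quotient.sound (Or.inr ⟨Or.inr (Or.inl rfl), Or.inl rfl⟩))).trans
        g.map_base)
      (fun a => (congrArg g.toMap (Quotient.sound (Or.inr ⟨Or.inr (Or.inr rfl), Or.inl rfl⟩))).trans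
        g.map_base), loops.continuous_ofFun _ _ _ _⟩
  map_base := by
    ext t
    exact (congrArg g.toMap (Quotient.sound (Or.inr ⟨Or.inl rfl, Or.inl rfl⟩))).trans g.map_base

theorem lift_susp_aux {A W : PointedSpace.{u}} {k : A → loops W} (hk : k A.base = (loops W).base)
    {p : A × I} (hp : p ∈ suspSet A) : loops.eval (k p.1) p.2 = W.base := by
  obtain ⟨a, t⟩ := p
  rcases hp with h | h | h
  · simp only at h
    subst h
    simp [hk]
  · simp only at h
    simp [h]
  · simp only at h
    simp [h]

/-- The map on a suspension given by a family of loops. -/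
def liftSusp {A W : PointedSpace.{u}} (k : A → loops W) (hk : k A.base = (loops W).base) :
    susp A → W :=
  Quotient.lift (fun p : A × I => loops.eval (k p.1) p.2) (by
    rintro p q (rfl | ⟨h, h'⟩)
    · rfl
    · rw [lift_susp_aux hk h, lift_susp_aux hk h'])

/-- The adjoint of a map into a loop space. -/
def uncurryPMap {A W : PointedSpace.{u}} (f : PMap A (loops W)) : PMap (susp A) W where
  toMap := ⟨liftSusp f.toMap f.map_base, Continuous.quotient_lift
    (loops.continuous_eval (f.toMap.continuous.comp continuous_fst) continuous_snd) _⟩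
  map_base := loops.eval_zero _

theorem curryPMap_uncurryPMap {A W : PointedSpace.{u}} (f : PMap A (loops W)) :
    curryPMap (uncurryPMap f) = f := rfl

theorem uncurryPMap_curryPMap {A W : PointedSpace.{u}} (g : PMap (susp A) W) :
    uncurryPMap (curryPMap g) = g := by
  ext q
  obtain ⟨p, rfl⟩ := Quotient.exists_rep q
  rfl

theorem curryPMap_homotopic {A W : PointedSpace.{u}} {g g' : PMap (susp A) W}
    (h : g.Homotopic g') : (curryPMap g).Homotopic (curryPMap g') :=
  (loops.map_homotopic h).comp_right (curryPMap (PMap.id (susp A)))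

theorem uncurryPMap_homotopic {A W : PointedSpace.{u}} {f f' : PMap A (loops W)}
    (h : f.Homotopic f') : (uncurryPMap f).Homotopic (uncurryPMap f') := by
  obtain ⟨K, hK, h0, h1, hb⟩ := h.exists_continuous
  refine .of_continuous (fun p => liftSusp (fun a => K (a, p.2)) (hb p.2) p.1) ?_ (fun q => ?_)
    (fun q => ?_) fun t => loops.eval_zero _
  · have hq : IsQuotientMap (Quotient.mk (collapseSetoid (suspSet A)) : A × I → susp A) :=
      isQuotientMap_quotient_mk'
    refine hq.continuous_lift_prod_left ?_
    exact loops.continuous_eval (hK.comp ((continuous_fst.comp continuous_fst).prodMk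
      continuous_snd)) (continuous_snd.comp continuous_fst)
  · obtain ⟨p, rfl⟩ := Quotient.exists_rep q
    exact congrArg (fun γ => loops.eval γ p.2) (h0 p.1)
  · obtain ⟨p, rfl⟩ := Quotient.exists_rep q
    exact congrArg (fun γ => loops.eval γ p.2) (h1 p.1)

/-- The adjunction on homotopy classes, as an isomorphism of groups. -/
def Bracket.curryEquiv (A W : PointedSpace.{u}) :
    Bracket (susp A) (loops (loops W)) ≃+ Bracket A (loops (loops (loops W))) where
  toFun := Quotient.map curryPMap fun _ _ h => curryPMap_homotopic h
  invFun := Quotient.map uncurryPMap fun _ _ h => uncurryPMap_homotopic h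
  left_inv := ind fun g => congrArg mk (uncurryPMap_curryPMap g)
  right_inv := ind fun f => congrArg mk (curryPMap_uncurryPMap f)
  map_add' x y := by
    refine Eq.trans ?_ (innerAdd_eq_add (W := loops W) _ _)
    revert x y
    exact ind fun f => ind fun g => rfl

/-! ### Exactness on cofibre sequences -/

/-- Points slide along the cone lines to the vertex; the homotopy is pointed because the line over
the base point is collapsed. -/
theorem reducedConeIncl_comp_homotopic_const {A B : PointedSpace.{u}} (f : PMap A B) :
    ((reducedConeIncl f).comp f).Homotopic (PMap.const A (reducedCone f)) := by
  have hbase : (Quot.mk _ (Sum.inl B.base) : MappingCone f.toMap) ∈ coneLine f :=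
    ⟨1, (Quot.sound (ConeRel.glue _)).trans (by rw [f.map_base])⟩
  refine .of_continuous (fun p => (Quotient.mk (collapseSetoid (coneLine f))
    (Quot.mk _ (Sum.inr (p.1, σ p.2))) : reducedCone f)) ?_ (fun a => ?_) (fun a => ?_) fun t => ?_
  · exact continuous_quotient_mk'.comp (continuous_quot_mk.comp
      (continuous_inr.comp (by fun_prop)))
  · refine congrArg (Quotient.mk _) ?_
    simp only [unitInterval.symm_zero]
    exact Quot.sound (ConeRel.glue a)
  · refine Quotient.sound (Or.inr ⟨⟨0, ?_⟩, hbase⟩)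
    simp only [unitInterval.symm_one]
    exact Quot.sound (ConeRel.vertex _ _)
  · exact Quotient.sound (Or.inr ⟨⟨σ t, rfl⟩, hbase⟩)

/-- A null-homotopy is an extension over the cone, and being pointed it descends to the reduced
cone. -/
theorem exists_extension_reducedCone {A B V : PointedSpace.{u}} (f : PMap A B) (α : PMap B V)
    (h : (α.comp f).Homotopic (PMap.const A V)) :
    ∃ β : PMap (reducedCone f) V, β.comp (reducedConeIncl f) = α := by
  obtain ⟨K, hK, h0, h1, hb⟩ := h.exists_continuous
  let b : C(MappingCone f.toMap, V) :=
    ⟨Quot.lift (Sum.elim α.toMap fun w : A × I => K (w.1, σ w.2)) (by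
      rintro _ _ (z | ⟨z, z'⟩)
      · simp only [Sum.elim_inr, Sum.elim_inl, unitInterval.symm_one]
        exact h0 z
      · simp only [Sum.elim_inr, unitInterval.symm_zero]
        rw [h1, h1]
        rfl), continuous_quot_lift _ (continuous_sumElim.2 ⟨α.toMap.continuous, by fun_prop⟩)⟩
  have hbl : ∀ q ∈ coneLine f, b q = V.base := by
    rintro _ ⟨t, rfl⟩
    exact hb (σ t)
  refine ⟨⟨⟨Quotient.lift b (by
    rintro p q (rfl | ⟨hp, hq⟩)
    · rfl
    · rw [hbl p hp, hbl q hq]), b.continuous.quotient_lift _⟩, α.map_base⟩, rfl⟩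

end LS

namespace LS

open Topology Metric Set

/-! ### Sequential colimits of abelian groups -/

section SeqColim

variable {G : ℕ → Type u} [∀ j, AddCommGroup (G j)] (t : ∀ j, G j →+ G (j + 1))

/-- The composite of the maps of a sequence of abelian groups from stage `i` to stage `j`. -/
def seqTrans (i j : ℕ) (h : i ≤ j) : G i →+ G j :=
  Nat.leRec (motive := fun j _ => G i →+ G j) (AddMonoidHom.id (G i)) (fun k _ φ => (t k).comp φ) h

@[simp] theorem seqTrans_self (i : ℕ) (h : i ≤ i) (x : G i) : seqTrans t i i h x = x := by
  rw [seqTrans, Nat.leRec_self]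
  rfl

theorem seqTrans_succ (i j : ℕ) (h : i ≤ j) (h' : i ≤ j + 1) (x : G i) :
    seqTrans t i (j + 1) h' x = t j (seqTrans t i j h x) := by
  rw [seqTrans, Nat.leRec_succ _ _ h]
  rfl

instance : DirectedSystem G fun i j h => seqTrans t i j h where
  map_self i x := seqTrans_self t i le_rfl x
  map_map c j i hij hjk x := by
    induction c, hjk using Nat.le_induction with
    | base => rw [seqTrans_self]
    | succ c hjk ih => rw [seqTrans_succ t _ c hjk, ih, seqTrans_succ t _ c (hij.trans hjk)]

/-- The colimit of a sequence of abelian groups. -/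
def SeqColim : Type u := AddCommGroup.DirectLimit G (seqTrans t)

instance : AddCommGroup (SeqColim t) :=
  inferInstanceAs (AddCommGroup (AddCommGroup.DirectLimit G (seqTrans t)))

namespace SeqColim

/-- The map of a stage into the colimit. -/
def of (j : ℕ) : G j →+ SeqColim t := AddCommGroup.DirectLimit.of G (seqTrans t) j

theorem of_succ (j : ℕ) (x : G j) : of t (j + 1) (t j x) = of t j x := by
  have := AddCommGroup.DirectLimit.of_f (f := seqTrans t) (Nat.le_succ j) x
  rw [← seqTrans_self t j le_rfl x, ← seqTrans_succ t j j le_rfl (Nat.le_succ j), seqTrans_self]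
  exact this

theorem of_seqTrans (i j : ℕ) (h : i ≤ j) (x : G i) : of t j (seqTrans t i j h x) = of t i x :=
  AddCommGroup.DirectLimit.of_f (f := seqTrans t) h x

theorem exists_of (x : SeqColim t) : ∃ j y, of t j y = x :=
  AddCommGroup.DirectLimit.induction_on (f := seqTrans t) x fun j y => ⟨j, y, rfl⟩

theorem exists_seqTrans_eq_zero {i : ℕ} {x : G i} (h : of t i x = 0) :
    ∃ j, ∃ hij : i ≤ j, seqTrans t i j hij x = 0 :=
  AddCommGroup.DirectLimit.of.zero_exact i x h

variable {t}

/-- Homomorphisms out of the colimit. -/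
def lift {P : Type u} [AddCommGroup P] (g : ∀ j, G j →+ P) (hg : ∀ j x, g (j + 1) (t j x) = g j x) :
    SeqColim t →+ P :=
  AddCommGroup.DirectLimit.lift G (seqTrans t) P g (by
    intro i j hij x
    induction j, hij using Nat.le_induction with
    | base => rw [seqTrans_self]
    | succ j hij ih => rw [seqTrans_succ t i j hij, hg, ih])

@[simp] theorem lift_of {P : Type u} [AddCommGroup P] (g : ∀ j, G j →+ P)
    (hg : ∀ j x, g (j + 1) (t j x) = g j x) (j : ℕ) (x : G j) : lift g hg (of t j x) = g j x :=
  AddCommGroup.DirectLimit.lift_of (f := seqTrans t) ..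

variable {G' : ℕ → Type u} [∀ j, AddCommGroup (G' j)] {t' : ∀ j, G' j →+ G' (j + 1)}

/-- The homomorphism of colimits induced by a homomorphism of sequences. -/
def map (φ : ∀ j, G j →+ G' j) (hφ : ∀ j x, φ (j + 1) (t j x) = t' j (φ j x)) :
    SeqColim t →+ SeqColim t' :=
  lift (fun j => (of t' j).comp (φ j)) fun j x => by
    simp only [AddMonoidHom.comp_apply]
    rw [hφ, of_succ]

@[simp] theorem map_of (φ : ∀ j, G j →+ G' j) (hφ : ∀ j x, φ (j + 1) (t j x) = t' j (φ j x))
    (j : ℕ) (x : G j) : map φ hφ (of t j x) = of t' j (φ j x) :=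
  lift_of ..

theorem map_seqTrans (φ : ∀ j, G j →+ G' j) (hφ : ∀ j x, φ (j + 1) (t j x) = t' j (φ j x))
    (i j : ℕ) (h : i ≤ j) (x : G i) : φ j (seqTrans t i j h x) = seqTrans t' i j h (φ i x) := by
  induction j, h using Nat.le_induction with
  | base => rw [seqTrans_self, seqTrans_self]
  | succ j h ih => rw [seqTrans_succ t i j h, seqTrans_succ t' i j h, hφ, ih]

/-- A sequence of isomorphisms induces an isomorphism of the colimits. -/
def congr (e : ∀ j, G j ≃+ G' j)
    (he : ∀ j x, (e (j + 1)).toAddMonoidHom (t j x) = t' j ((e j).toAddMonoidHom x)) :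
    SeqColim t ≃+ SeqColim t' :=
  AddEquiv.ofBijective (map (fun j => (e j).toAddMonoidHom) he) (by
    constructor
    · rw [injective_iff_map_eq_zero]
      intro x hx
      obtain ⟨j, y, rfl⟩ := exists_of t x
      rw [map_of] at hx
      obtain ⟨k, hjk, h⟩ := exists_seqTrans_eq_zero t' hx
      have h' := map_seqTrans (fun j => (e j).toAddMonoidHom) he j k hjk y
      rw [h] at h'
      rw [← of_seqTrans t j k hjk, (e k).map_eq_zero_iff.1 h', map_zero]
    · intro x
      obtain ⟨j, y, rfl⟩ := exists_of t' x
      refine ⟨of t j ((e j).symm y), (map_of _ he j _).trans ?_⟩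
      exact congrArg (of t' j) ((e j).apply_symm_apply y))

@[simp] theorem congr_of (e : ∀ j, G j ≃+ G' j)
    (he : ∀ j x, (e (j + 1)).toAddMonoidHom (t j x) = t' j ((e j).toAddMonoidHom x)) (j : ℕ) (x : G j) : congr e he (of t j x) = of t' j (e j x) :=
  map_of (fun j => (e j).toAddMonoidHom) he j x

variable (t)

/-- The colimit does not change if the first stage is dropped. -/
def shift : SeqColim (fun j => t (j + 1)) ≃+ SeqColim t :=
  AddEquiv.ofBijective (lift (t := fun j => t (j + 1)) (fun j => of t (j + 1))
    fun j x => of_succ t (j + 1) x) (by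
    have htrans : ∀ i j (h : i ≤ j) (x : G (i + 1)), seqTrans (fun j => t (j + 1)) i j h x =
        seqTrans t (i + 1) (j + 1) (Nat.succ_le_succ h) x := by
      intro i j h x
      induction j, h using Nat.le_induction with
      | base => rw [seqTrans_self, seqTrans_self]
      | succ j h ih =>
        rw [seqTrans_succ _ i j h, seqTrans_succ t (i + 1) (j + 1) (Nat.succ_le_succ h), ih]
    constructor
    · rw [injective_iff_map_eq_zero]
      intro x hx
      obtain ⟨j, y, rfl⟩ := exists_of _ x
      rw [lift_of] at hx
      obtain ⟨k, hjk, h⟩ := exists_seqTrans_eq_zero t hx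
      obtain ⟨k, rfl⟩ : ∃ k', k = k' + 1 := ⟨k - 1, by omega⟩
      rw [← of_seqTrans _ j k (by omega), htrans, h, map_zero]
    · intro x
      obtain ⟨j, y, rfl⟩ := exists_of t x
      exact ⟨of _ j (t j y), by rw [lift_of, of_succ]⟩)

theorem shift_of (j : ℕ) (x : G (j + 1)) :
    shift t (of (fun j => t (j + 1)) j x) = of t (j + 1) x :=
  lift_of (t := fun j => t (j + 1)) (fun j => of t (j + 1)) (fun j x => of_succ t (j + 1) x) j x

end SeqColim

end SeqColim

/-! ### Cohomology groups represented by a tower of spaces -/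

/-- A sequence of pointed spaces and maps. -/
structure Tower : Type (u + 1) where
  obj : ℕ → PointedSpace.{u}
  map : ∀ j, PMap (obj j) (obj (j + 1))

namespace Tower

/-- The tower of the loop spaces. -/
def loops (S : Tower.{u}) : Tower.{u} := ⟨fun j => LS.loops (S.obj j), fun j => LS.loops.map (S.map j)⟩

/-- The tower without its first stage. -/
def shift (S : Tower.{u}) : Tower.{u} := ⟨fun j => S.obj (j + 1), fun j => S.map (j + 1)⟩

/-- The colimit of the groups of homotopy classes of maps into the double loop spaces of the spaces
of a tower. -/
def Coh (S : Tower.{u}) (A : PointedSpace.{u}) : Type u :=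
  SeqColim fun j => Bracket.postcompHom A (S.map j)

variable (S : Tower.{u}) {A B C : PointedSpace.{u}}

instance : AddCommGroup (S.Coh A) :=
  inferInstanceAs (AddCommGroup (SeqColim fun j => Bracket.postcompHom A (S.map j)))

/-- The class represented at stage `j` by a map. -/
def cls (j : ℕ) (f : PMap A (LS.loops (LS.loops (S.obj j)))) : S.Coh A :=
  SeqColim.of (fun j => Bracket.postcompHom A (S.map j)) j (Bracket.mk f)

theorem cls_succ (j : ℕ) (f : PMap A (LS.loops (LS.loops (S.obj j)))) :
    S.cls (j + 1) ((LS.loops.map (LS.loops.map (S.map j))).comp f) = S.cls j f :=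
  SeqColim.of_succ (fun j => Bracket.postcompHom A (S.map j)) j (Bracket.mk f)

theorem exists_cls (x : S.Coh A) : ∃ j f, S.cls j f = x := by
  obtain ⟨j, y, h⟩ := SeqColim.exists_of _ x
  obtain ⟨f, rfl⟩ := Quotient.exists_rep y
  exact ⟨j, f, h⟩

theorem cls_eq_of_homotopic {j : ℕ} {f g : PMap A (LS.loops (LS.loops (S.obj j)))}
    (h : f.Homotopic g) : S.cls j f = S.cls j g :=
  congrArg (SeqColim.of _ j) (Bracket.mk_eq_mk.2 h)

theorem cls_const (j : ℕ) : S.cls j (PMap.const A _) = 0 :=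
  map_zero (SeqColim.of (fun j => Bracket.postcompHom A (S.map j)) j)

/-- The composite of the maps of a tower from stage `j` to stage `j + r`. -/
def comp (j : ℕ) : ∀ r, PMap (S.obj j) (S.obj (j + r))
  | 0 => PMap.id _
  | r + 1 => (S.map (j + r)).comp (comp j r)

/-- An element of a sequential colimit vanishes only if it already does so at a finite stage. -/
theorem cls_eq_zero {j : ℕ} {f : PMap A (LS.loops (LS.loops (S.obj j)))} (h : S.cls j f = 0) :
    ∃ r, ((LS.loops.map (LS.loops.map (S.comp j r))).comp f).Homotopic (PMap.const A _) := by
  obtain ⟨k, hjk, hk⟩ := SeqColim.exists_seqTrans_eq_zero _ h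
  obtain ⟨r, rfl⟩ := Nat.exists_eq_add_of_le hjk
  refine ⟨r, Bracket.mk_eq_mk.1 (Eq.trans ?_ hk)⟩
  clear hk h
  induction r with
  | zero => exact (seqTrans_self (fun j => Bracket.postcompHom A (S.map j)) j hjk _).symm
  | succ r ih =>
    refine Eq.trans ?_ (seqTrans_succ (fun j => Bracket.postcompHom A (S.map j)) j (j + r)
      (Nat.le_add_right j r) hjk _).symm
    rw [← ih (Nat.le_add_right j r)]
    rfl

theorem cls_comp (j r : ℕ) (f : PMap A (LS.loops (LS.loops (S.obj j)))) :
    S.cls (j + r) ((LS.loops.map (LS.loops.map (S.comp j r))).comp f) = S.cls j f := by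
  induction r with
  | zero => rfl
  | succ r ih => exact (S.cls_succ (j + r) _).trans ih

/-- The homomorphism induced by a pointed map. -/
def cohMap (φ : PMap A B) : S.Coh B →+ S.Coh A :=
  SeqColim.map (fun _ => Bracket.precompHom _ φ) fun j x => by
    revert x
    exact Bracket.ind fun f => rfl

@[simp] theorem cohMap_cls (φ : PMap A B) (j : ℕ) (f : PMap B (LS.loops (LS.loops (S.obj j)))) :
    S.cohMap φ (S.cls j f) = S.cls j (f.comp φ) :=
  SeqColim.map_of ..

theorem cohMap_id (x : S.Coh A) : S.cohMap (PMap.id A) x = x := by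
  obtain ⟨j, f, rfl⟩ := S.exists_cls x
  simp

theorem cohMap_comp (g : PMap B C) (f : PMap A B) (x : S.Coh C) :
    S.cohMap (g.comp f) x = S.cohMap f (S.cohMap g x) := by
  obtain ⟨j, k, rfl⟩ := S.exists_cls x
  simp [PMap.comp_assoc]

theorem cohMap_homotopic {f g : PMap A B} (h : f.Homotopic g) : S.cohMap f = S.cohMap g := by
  ext x
  obtain ⟨j, k, rfl⟩ := S.exists_cls x
  simp only [cohMap_cls]
  exact S.cls_eq_of_homotopic (h.comp_left k)

/-- Exactness is inherited from the stages: a class killed by `f` has a representative that is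
null-homotopic on `A` at a later stage, and that representative extends over the cone. -/
theorem cohMap_exact (f : PMap A B) (x : S.Coh B) :
    S.cohMap f x = 0 ↔ ∃ y, S.cohMap (reducedConeIncl f) y = x := by
  constructor
  · intro h
    obtain ⟨j, k, rfl⟩ := S.exists_cls x
    rw [cohMap_cls] at h
    obtain ⟨r, hr⟩ := S.cls_eq_zero h
    obtain ⟨β, hβ⟩ := exists_extension_reducedCone f
      ((LS.loops.map (LS.loops.map (S.comp j r))).comp k) hr
    exact ⟨S.cls (j + r) β, by rw [cohMap_cls, hβ, cls_comp]⟩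
  · rintro ⟨y, rfl⟩
    obtain ⟨j, k, rfl⟩ := S.exists_cls y
    rw [← cohMap_comp, S.cohMap_homotopic (reducedConeIncl_comp_homotopic_const f), cohMap_cls,
      PMap.comp_const, cls_const]

/-- The suspension isomorphism. -/
def cohSusp (A : PointedSpace.{u}) : S.Coh (susp A) ≃+ S.loops.Coh A :=
  SeqColim.congr (fun j => Bracket.curryEquiv A (S.obj j)) fun j x => by
    revert x
    exact Bracket.ind fun f => rfl

theorem cohSusp_cls (j : ℕ) (f : PMap (susp A) (LS.loops (LS.loops (S.obj j)))) :
    S.cohSusp A (S.cls j f) = S.loops.cls j (curryPMap f) :=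
  SeqColim.congr_of ..

theorem cohSusp_natural (f : PMap A B) (x : S.Coh (susp B)) :
    S.cohSusp A (S.cohMap (suspMap f) x) = S.loops.cohMap f (S.cohSusp B x) := by
  obtain ⟨j, k, rfl⟩ := S.exists_cls x
  rw [cohMap_cls, cohSusp_cls, cohSusp_cls, cohMap_cls]
  rfl

/-- The cohomology groups of a tower do not change if the first stage is dropped. -/
def cohShift (A : PointedSpace.{u}) : S.shift.Coh A ≃+ S.Coh A :=
  SeqColim.shift fun j => Bracket.postcompHom A (S.map j)

theorem cohShift_cls (j : ℕ) (f : PMap A (LS.loops (LS.loops (S.obj (j + 1))))) :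
    S.cohShift A (S.shift.cls j f) = S.cls (j + 1) f :=
  SeqColim.shift_of ..

theorem cohShift_natural (f : PMap A B) (x : S.shift.Coh B) :
    S.cohShift A (S.shift.cohMap f x) = S.cohMap f (S.cohShift B x) := by
  obtain ⟨j, k, rfl⟩ := S.shift.exists_cls x
  rw [cohMap_cls]
  refine (S.cohShift_cls j (k.comp f)).trans (Eq.symm ?_)
  exact (congrArg (S.cohMap f) (S.cohShift_cls j k)).trans (S.cohMap_cls f (j + 1) k)

end Tower

/-- A sequence of towers, indexed by the integers, in which every tower is the loop tower of the
next one, possibly up to dropping the first stage. -/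
structure TowerSpectrum : Type (u + 1) where
  tower : ℤ → Tower.{u}
  link : ∀ n m, n + 1 = m → tower n = (tower m).loops ∨ (tower n).shift = (tower m).loops

theorem TowerSpectrum.exists_suspIso (T : TowerSpectrum.{u}) (n m : ℤ) (h : n + 1 = m) :
    ∃ e : ∀ A : PointedSpace.{u}, (T.tower n).Coh A ≃+ (T.tower m).Coh (susp A),
      ∀ (A B : PointedSpace.{u}) (f : PMap A B) (x : (T.tower n).Coh B),
        (T.tower m).cohMap (suspMap f) (e B x) = e A ((T.tower n).cohMap f x) := by
  rcases T.link n m h with h | h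
  · rw [h]
    refine ⟨fun A => ((T.tower m).cohSusp A).symm, fun A B f x => ?_⟩
    rw [AddEquiv.eq_symm_apply, Tower.cohSusp_natural, AddEquiv.apply_symm_apply]
  -- Stated for the shifted tower alone, so that the equality of towers can be rewritten; `cohShift`
  -- then returns to the unshifted tower.
  · have key : ∃ e : ∀ A : PointedSpace.{u}, (T.tower n).shift.Coh A ≃+ (T.tower m).Coh (susp A),
        ∀ (A B : PointedSpace.{u}) (f : PMap A B) (x : (T.tower n).shift.Coh B),
        (T.tower m).cohMap (suspMap f) (e B x) = e A ((T.tower n).shift.cohMap f x) := by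
      rw [h]
      refine ⟨fun A => ((T.tower m).cohSusp A).symm, fun A B f x => ?_⟩
      rw [AddEquiv.eq_symm_apply, Tower.cohSusp_natural, AddEquiv.apply_symm_apply]
    obtain ⟨e, he⟩ := key
    refine ⟨fun A => ((T.tower n).cohShift A).symm.trans (e A), fun A B f x => ?_⟩
    simp only [AddEquiv.trans_apply]
    rw [he]
    congr 1
    rw [AddEquiv.eq_symm_apply, Tower.cohShift_natural, AddEquiv.apply_symm_apply]

/-- The cohomology theory of a spectrum of towers. -/
def TowerSpectrum.theory (T : TowerSpectrum.{u}) : CohomologyTheory.{u} where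
  obj n X := (T.tower n).Coh X.toPointedSpace
  map n _ _ f := (T.tower n).cohMap f
  map_id n _ u := (T.tower n).cohMap_id u
  map_comp n _ _ _ g f u := (T.tower n).cohMap_comp g f u
  map_homotopic n _ _ _ _ h := (T.tower n).cohMap_homotopic h
  exact n _ _ f _ u := (T.tower n).cohMap_exact f u
  suspIso n m h X _ := (T.exists_suspIso n m h).choose X.toPointedSpace
  suspIso_natural n m h _ _ _ _ f u := (T.exists_suspIso n m h).choose_spec _ _ f u

/-! ### Stable cohomotopy -/

/-- The space `Ω ^ j Σ ^ j Z`. -/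
def loopSusp : ℕ → PointedSpace.{u} → PointedSpace.{u}
  | 0, Z => Z
  | j + 1, Z => loops (loopSusp j (susp Z))

/-- The unit of the adjunction between suspension and loops. -/
def loopUnit (Z : PointedSpace.{u}) : PMap Z (loops (susp Z)) := curryPMap (PMap.id (susp Z))

/-- The stabilisation map `Ω ^ j Σ ^ j Z → Ω ^ (j + 1) Σ ^ (j + 1) Z`. -/
def loopSuspMap : ∀ (j : ℕ) (Z : PointedSpace.{u}), PMap (loopSusp j Z) (loopSusp (j + 1) Z)
  | 0, Z => loopUnit Z
  | j + 1, Z => loops.map (loopSuspMap j (susp Z))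

/-- The iterated loop space. -/
def iterLoops : ℕ → PointedSpace.{u} → PointedSpace.{u}
  | 0, W => W
  | m + 1, W => loops (iterLoops m W)

/-- The iterated loop map. -/
def iterLoopsMap {W V : PointedSpace.{u}} (f : PMap W V) :
    ∀ m, PMap (iterLoops m W) (iterLoops m V)
  | 0 => f
  | m + 1 => loops.map (iterLoopsMap f m)

/-- The tower of the spaces `Ω ^ j Σ ^ j Z`. -/
def stableTower (Z : PointedSpace.{u}) : Tower.{u} :=
  ⟨fun j => loopSusp j Z, fun j => loopSuspMap j Z⟩

/-- The tower `Ω ^ j Σ ^ (j + n) Z` for an integer `n`. -/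
def stableTowerInt (Z : PointedSpace.{u}) : ℤ → Tower.{u}
  | .ofNat k => stableTower (iterSusp Z k)
  | .negSucc m => ⟨fun j => iterLoops (m + 1) (loopSusp j Z),
      fun j => iterLoopsMap (loopSuspMap j Z) (m + 1)⟩

/-- The spectrum of towers that represents stable cohomotopy with coefficients in `Z`. -/
def stableSpectrum (Z : PointedSpace.{u}) : TowerSpectrum.{u} where
  tower := stableTowerInt Z
  link := by
    rintro n m rfl
    -- For `n ≥ 0`, dropping the first stage uses `Ω^(j+1) Σ^(j+1) Σ^k Z = Ω (Ω^j Σ^j Σ^(k+1) Z)`;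
    -- for `n < 0`, a tower is literally the loop tower of the next.
    rcases n with k | _ | m
    · exact Or.inr rfl
    · exact Or.inl rfl
    · exact Or.inl rfl

/-- The map `Z → Ω ^ j Σ ^ j Z`. -/
def iterLoopUnit (Z : PointedSpace.{u}) : ∀ j, PMap Z (loopSusp j Z)
  | 0 => PMap.id Z
  | j + 1 => (loopSuspMap j Z).comp (iterLoopUnit Z j)

/-- The definition adds the last stabilisation outside; this form splits off the first unit, which
is what the adjunction can peel away. -/
theorem iterLoopUnit_succ (Z : PointedSpace.{u}) (j : ℕ) :
    iterLoopUnit Z (j + 1) = (loops.map (iterLoopUnit (susp Z) j)).comp (loopUnit Z) := by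
  induction j with
  | zero => rfl
  | succ j ih =>
    rw [iterLoopUnit, ih]
    rfl

/-- Suspending a map first and then `j` times. -/
theorem iterSuspMap_suspMap_homotopic_const_iff {A B : PointedSpace.{u}} (f : PMap A B) (j : ℕ) :
    (iterSuspMap (suspMap f) j).Homotopic (PMap.const _ _) ↔
      (iterSuspMap f (j + 1)).Homotopic (PMap.const _ _) := by
  -- The spaces on the two sides are equal only by induction on `j`, so the maps are compared
  -- together with their source and target.
  have key : (⟨iterSusp (susp A) j, iterSusp (susp B) j, iterSuspMap (suspMap f) j⟩ :
      Σ A B : PointedSpace.{u}, PMap A B) =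
      ⟨iterSusp A (j + 1), iterSusp B (j + 1), iterSuspMap f (j + 1)⟩ := by
    induction j with
    | zero => rfl
    | succ j ih => exact congrArg (fun s : Σ A B : PointedSpace.{u}, PMap A B =>
        (⟨susp s.1, susp s.2.1, suspMap s.2.2⟩ : Σ A B : PointedSpace.{u}, PMap A B)) ih
  exact (congrArg (fun s : Σ A B : PointedSpace.{u}, PMap A B =>
    s.2.2.Homotopic (PMap.const s.1 s.2.1)) key).to_iff

/-- The map `A → Z → Ω^j Σ^j Z` is adjoint to `Σ^j f`; the induction removes one loop at a time. -/
theorem iterSuspMap_homotopic_const {A Z : PointedSpace.{u}} (f : PMap A Z) (j : ℕ)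
    (h : ((iterLoopUnit Z j).comp f).Homotopic (PMap.const A _)) :
    (iterSuspMap f j).Homotopic (PMap.const _ _) := by
  induction j generalizing A Z with
  | zero => exact h
  | succ j ih =>
    rw [← iterSuspMap_suspMap_homotopic_const_iff]
    refine ih (suspMap f) ?_
    rw [iterLoopUnit_succ] at h
    have e : (iterLoopUnit (susp Z) j).comp (suspMap f) =
        uncurryPMap (((loops.map (iterLoopUnit (susp Z) j)).comp (loopUnit Z)).comp f) := by
      refine PMap.ext_fun fun q => ?_
      obtain ⟨p, rfl⟩ := Quotient.exists_rep q
      rfl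
    have e' : PMap.const (susp A) (loopSusp j (susp Z)) = uncurryPMap (PMap.const A _) := by
      refine PMap.ext_fun fun q => ?_
      obtain ⟨p, rfl⟩ := Quotient.exists_rep q
      rfl
    rw [e, e']
    exact uncurryPMap_homotopic h

/-- The stable class of a map `A → Z`. -/
def stableClass {A Z : PointedSpace.{u}} (f : PMap A Z) : ((stableSpectrum Z).tower 2).Coh A :=
  -- Degree `2` compensates for the double loops in `Coh`: stage `0` of this tower is `Σ² Z`.
  Tower.cls _ 0 ((iterLoopUnit Z 2).comp f : PMap A (loops (loops (susp (susp Z)))))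

/-- If the class vanished, then at some stage `A → Z → Ω^(r+2) Σ^(r+2) Z` would be null-homotopic,
and by adjunction so would `Σ^(r+2) f`. -/
theorem stableClass_ne_zero {A Z : PointedSpace.{u}} (f : PMap A Z) (hf : StablyNontrivial f) :
    stableClass f ≠ 0 := by
  intro h
  obtain ⟨r, hr⟩ := Tower.cls_eq_zero _ h
  refine hf (0 + r + 2) (iterSuspMap_homotopic_const f (0 + r + 2) ?_)
  have e : ∀ r, (loops.map (loops.map ((stableTower (susp (susp Z))).comp 0 r))).comp
      (iterLoopUnit Z 2) = iterLoopUnit Z (0 + r + 2) := by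
    intro r
    induction r with
    | zero => rfl
    | succ r ih =>
      refine Eq.trans ?_ (congrArg (fun k => (loopSuspMap (0 + r + 2) Z).comp k) ih)
      rfl
  rw [← e]
  exact hr

theorem cuplen_le_wgt (X : CWSpace.{u}) : cuplen X.toPointedSpace ≤ wgt X := by
  refine iSup_le fun k => iSup₂_le fun _ hk => ?_
  -- The theory depends on `X` and `k`: its coefficients are the smash power, so that the reduced
  -- diagonal itself represents a class.
  let h : CohomologyTheory.{u} := (stableSpectrum (smashPower X.toPointedSpace k)).theory
  let x : h.obj 2 X := stableClass (reducedDiagonal X.toPointedSpace k)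
  have hx : x ≠ 0 := stableClass_ne_zero _ hk
  have hw : (k : ℕ∞) ≤ wgtClass h x := by
    refine le_iSup₂_of_le k (fun K f hf => ?_) le_rfl
    refine (Tower.cohMap_cls _ f 0 _).trans ?_
    refine (Tower.cls_eq_of_homotopic _ (PMap.Homotopic.comp_left
      (reducedDiagonal_comp_homotopic_const K.hasCWType f hf) (iterLoopUnit _ 2))).trans ?_
    rw [PMap.comp_const]
    exact Tower.cls_const _ 0
  exact hw.trans (le_iSup_of_le h (le_iSup_of_le 2 (le_iSup₂_of_le x hx le_rfl)))

end LS

end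

theorem mainTheorem2 (X : LS.CWSpace.{u}) (hX : PathConnectedSpace X.carrier) :
    LS.cuplen X.toPointedSpace ≤ LS.wgt X ∧ LS.wgt X ≤ LS.Mwgt X ∧
      LS.Mwgt X ≤ LS.cat X.toPointedSpace :=
  ⟨LS.cuplen_le_wgt X, LS.wgt_le_Mwgt X, LS.Mwgt_le_cat X⟩
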